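/- \textbf{Setting.} Let $\mathcal H$ be a class of measurable classifiers $h:\mathcal X\to\{-1,1\}$ on a measurable space $\mathcal X$, with $|\mathcal H|\ge 3$ and finite VC dimension $d$. For a distribution $P$ on $\mathcal X\times\{-1,1\}$ let $R_P(h)=P(h(X)\ne Y)$ and $\mathcal E_P(h)=R_P(h)-\inf_{h'\in\mathcal H}R_P(h')$. Let $C_\beta\ge 2$, $C_\rho=3$, and $\rho_t\in(0,\infty]$ for $t\in[N]$. The multisource class $\mathcal M$ with exponents $(\rho_t)_{t\in[N]}$ and sample sizes $(n_t)_{t\in[N+1]}$ consists of all products $\Pi=\prod_{t\in[N]}P_t^{n_t}\times\mathcal D^{n_{\mathcal D}}$, where $P_{N+1}=\mathcal D$ is the target and $n_{N+1}=n_{\mathcal D}$, such that (A1) some $h^*\in\mathcal H$ minimizes $R_{P_t}$ over $\mathcal H$ for every $t\in[N+1]$; (A2) $\mathcal E_{\mathcal D}(h)\le C_\rho\,\mathcal E_{P_t}(h)^{1/\rho_t}$ for all $h\in\mathcal H$, $t\in[N]$; (A3) $P_t(h\ne h^*_{P_t})\le C_\beta\,\mathcal E_{P_t}(h)^{\beta}$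 for all $h\in\mathcal H$, $t\in[N+1]$ and every minimizer $h^*_{P_t}\in\mathcal H$ of $R_{P_t}$. (Here $0^0=1$, $1/\infty=0$ and $1/0=\infty$.) A learner is any function from multisamples $Z=(Z_t)_{t\in[N+1]}$, $|Z_t|=n_t$, to $\mathcal H$; for a non-measurable learner, $\mathbb P$ and $\mathbb E$ below are outer probability and upper expectation. \textbf{Theorem.} There are universal constants $C_0,C_1,c,C>0$ such that the following holds for every such $\mathcal H$. Let $0\le\beta<1$, $C_\beta\ge2$, $1\le n<2/\beta-1$, $n_{\mathcal D}\ge0$, and let $N=N_P+N_Q$ with $N_Q\ge C_0$, $N_P\ge 3N_Q$ and $$N_P^{(2-(n+1)\beta)/(2-\beta)}\ \ge\ C_1\,N_Q^2\,2^{15n}.$$ Let $\boldsymbol{\mathcal M}$ be the family of all multisource classes $\mathcal M$ with these parameters, with $n_t=n$ for $t\in[N]$ and $n_{N+1}=n_{\mathcal D}$, for which at least $\frac12N_Q$ of the exponents $\rho_t$, $t\in[N]$, are at most $1$. (1) Over all learners $\hat h$ (which do not know $\mathcal M$), $$\inf_{\hat h}\ \sup_{\mathcal M\in\boldsymbol{\mathcal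 M}}\ \sup_{\Pi\in\mathcal M}\ \mathbb P_\Pi\Big(\mathcal E_{\mathcal D}(\hat h)\ge\tfrac14\big(1\wedge n_{\mathcal D}^{-1/(2-\beta)}\big)\Big)\ \ge\ c.$$ (2) Suppose that for all $m$ and $s\in\{-1,1\}^m$ the set of $(x_1,\dots,x_m)\in\mathcal X^m$ such that some $h\in\mathcal H$ has $h(x_i)=s_i$ for all $i$ is universally measurable (the usual measurability convention for VC classes). Then for all $n$, $n_{\mathcal D}$, $N$ there is a learner $\tilde h$ which, given $Z$ and a permutation that sorts the tasks $t\in[N+1]$ by increasing exponent (with $\rho_{N+1}=1$), and no other information on $\mathcal M$ or on $\beta,C_\beta,N_P,N_Q$, satisfies, for all parameters and $\boldsymbol{\mathcal M}$ as above, $$\sup_{\mathcal M\in\boldsymbol{\mathcal M}}\ \sup_{\Pi\in\mathcal M}\ \mathbb E_\Pi\big[\mathcal E_{\mathcal D}(\tilde h)\big]\ \le\ C\left(C_\beta\,\frac{d\log(nN_Q/d)+\log(nN_Q)}{n\,N_Q}\right)^{1/(2-\beta)},\qquad \log x:=\max\{\ln x,1\}.$$ -/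

import Mathlib

open MeasureTheory
open scoped ENNReal

namespace Multisource

noncomputable section

variable {X : Type*}

/-! Classifiers are functions `X → Bool`; the two values of `Bool` are the two labels `±1`. -/

/-- `H` shatters the finite set `S`: every labelling of `S` is realized by a member of `H`. -/
def Shatters (H : Set (X → Bool)) (S : Finset X) : Prop :=
  ∀ f : X → Bool, ∃ h ∈ H, ∀ x ∈ S, h x = f x

/-- The Vapnik-Chervonenkis dimension (`⊤` if arbitrarily large finite sets are shattered). -/
def vcDim (H : Set (X → Bool)) : ℕ∞ :=
  ⨆ (S : Finset X) (_ : Shatters H S), (S.card : ℕ∞)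

variable [MeasurableSpace X]

/-- The measurability convention of empirical process theory: for each pattern of labels, the set
of finite point sequences on which some member of `H` realizes that pattern is universally
measurable (it is measurable up to a null set for every probability measure). -/
def TraceMeasurable (H : Set (X → Bool)) : Prop :=
  ∀ (m : ℕ) (s : Fin m → Bool) (μ : Measure (Fin m → X)), IsProbabilityMeasure μ →
    NullMeasurableSet {x : Fin m → X | ∃ h ∈ H, ∀ i, h (x i) = s i} μ

/-- The 0-1 risk `P(h(X) ≠ Y)`. -/
def risk (P : Measure (X × Bool)) (h : X → Bool) : ℝ :=
  P.real {z | h z.1 ≠ z.2}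

/-- The excess risk of `h` over the best in class. -/
def excessRisk (H : Set (X → Bool)) (P : Measure (X × Bool)) (h : X → Bool) : ℝ :=
  risk P h - ⨅ h' : H, risk P h'

/-- The pseudo-distance `P(h ≠ h')`, the mass of the set of `x` with `h x ≠ h' x`. -/
def disagreement (P : Measure (X × Bool)) (h h' : X → Bool) : ℝ :=
  P.real {z | h z.1 ≠ h' z.1}

/-- `h` is a best-in-class classifier for `P`. -/
def IsBest (H : Set (X → Bool)) (P : Measure (X × Bool)) (h : X → Bool) : Prop :=
  h ∈ H ∧ ∀ h' ∈ H, risk P h ≤ risk P h'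

/-- The Bernstein class condition with parameters `(Cβ, β)`, for any best-in-class `hs`. -/
def BernsteinClass (H : Set (X → Bool)) (Cβ β : ℝ) (P : Measure (X × Bool)) : Prop :=
  ∀ hs, IsBest H P hs → ∀ h ∈ H, disagreement P h hs ≤ Cβ * excessRisk H P h ^ β

/-- `P` has transfer exponent `(Cρ, ρ)` with respect to `D`, where `0 < ρ ≤ ∞`. For `ρ = ∞` the
power `1 / ρ` is `0`, and `0 ^ 0 = 1`. -/
def HasTransferExponent (H : Set (X → Bool)) (Cρ : ℝ) (ρ : ℝ≥0∞)
    (P D : Measure (X × Bool)) : Prop :=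
  ∀ h ∈ H, excessRisk H D h ≤ Cρ * excessRisk H P h ^ (ρ⁻¹).toReal

/-- The multisource class with `N` sources and exponents `ρ`. A member is given by its task
distributions: the sources `P t.castSucc`, `t : Fin N`, and the target `P (Fin.last N)`; the
corresponding product distribution on multisamples is `sampleLaw`. -/
def multisourceClass {N : ℕ} (H : Set (X → Bool)) (Cρ : ℝ) (ρ : Fin N → ℝ≥0∞) (Cβ β : ℝ) :
    Set (Fin (N + 1) → ProbabilityMeasure (X × Bool)) :=
  {P | (∃ hs, ∀ t, IsBest H (P t) hs) ∧
    (∀ t : Fin N, HasTransferExponent H Cρ (ρ t) (P t.castSucc) (P (Fin.last N))) ∧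
    ∀ t, BernsteinClass H Cβ β (P t)}

/-- A multisample with sample sizes `m`. -/
abbrev Multisample (X : Type*) {N : ℕ} (m : Fin (N + 1) → ℕ) : Type _ :=
  ∀ t, Fin (m t) → X × Bool

/-- A (proper) multisource learner is any function from multisamples to the class `H`. -/
abbrev Learner (H : Set (X → Bool)) {N : ℕ} (m : Fin (N + 1) → ℕ) : Type _ :=
  Multisample X m → H

/-- The law of the multisample: all sample points are independent, those of task `t` are
distributed according to `P t`. -/
def sampleLaw {N : ℕ} (P : Fin (N + 1) → ProbabilityMeasure (X × Bool)) (m : Fin (N + 1) → ℕ) :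
    Measure (Multisample X m) :=
  Measure.pi fun t => Measure.pi fun _ : Fin (m t) => (P t : Measure (X × Bool))

/-- The (upper) expectation of a nonnegative function. It is `∫⁻ ω, f ω ∂μ` when `f` is
measurable; learners are arbitrary functions, so this need not be the case. -/
def expectation {Ω : Type*} [MeasurableSpace Ω] (μ : Measure Ω) (f : Ω → ℝ≥0∞) : ℝ≥0∞ :=
  ⨅ (g : Ω → ℝ≥0∞) (_ : Measurable g) (_ : ∀ ω, f ω ≤ g ω), ∫⁻ ω, g ω ∂μ

/-- Sample sizes: `n` for each of the `N` sources, `nD` for the target. -/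
def sampleSizes (N n nD : ℕ) : Fin (N + 1) → ℕ :=
  Fin.snoc (α := fun _ => ℕ) (fun _ => n) nD

/-- The exponents of all tasks: those of the sources, and `1` for the target. -/
def allExponents {N : ℕ} (ρ : Fin N → ℝ≥0∞) : Fin (N + 1) → ℝ≥0∞ :=
  Fin.snoc (α := fun _ => ℝ≥0∞) ρ 1

/-- `π` ranks the tasks by increasing exponent: `π 0, π 1, …` is the order `(1), (2), …`. -/
def IsRanking {N : ℕ} (ρ : Fin N → ℝ≥0∞) (π : Equiv.Perm (Fin (N + 1))) : Prop :=
  Monotone fun i => allExponents ρ (π i)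

/-- The admissible exponents of the sources: they lie in `(0, ∞]`, and at least `NQ / 2` of them
are at most `1`. They index the family of multisource classes. -/
def exponentFamily (N NQ : ℕ) : Set (Fin N → ℝ≥0∞) :=
  {ρ | (∀ t, 0 < ρ t) ∧ (NQ : ℝ) / 2 ≤ ({t | ρ t ≤ 1} : Set (Fin N)).ncard}

/-- The conditions on the parameters. The condition `n < 2 / β - 1` is written as
`(n + 1) * β < 2`, so that it is void for `β = 0`. -/
structure Regime (C₀ C₁ β Cβ : ℝ) (n NP NQ : ℕ) : Prop where
  beta_nonneg : 0 ≤ β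
  beta_lt_one : β < 1
  two_le_Cbeta : 2 ≤ Cβ
  one_le_n : 1 ≤ n
  n_lt : ((n : ℝ) + 1) * β < 2
  le_NQ : C₀ ≤ (NQ : ℝ)
  le_NP : 3 * NQ ≤ NP
  NP_large : C₁ * (NQ : ℝ) ^ 2 * 2 ^ (15 * n) ≤
    (NP : ℝ) ^ ((2 - ((n : ℝ) + 1) * β) / (2 - β))

/-- `min {1, nD ^ (-1 / (2 - β))}`, which is `1` for `nD = 0` (convention `1 / 0 = ∞`). -/
def targetRate (β : ℝ) (nD : ℕ) : ℝ :=
  if nD = 0 then 1 else min 1 ((nD : ℝ) ^ (-(1 / (2 - β))))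

/-- The positive logarithm `max {ln x, 1}`. -/
def posLog (x : ℝ) : ℝ := max (Real.log x) 1

end

end Multisource

open Multisource

/-! Lower bound. Two classifiers in `H` agree at a point `x₀` and differ at `x₁`
(`exists_agree_differ`). A hidden bit `b` is the better label of `x₁`, and the label that a
learner's output gives to `x₁` is a test for `b`. The target shows `x₁` so rarely and with so little
bias that `nD` points do not reveal `b`. Each source is, independently with probability `q = NQ /
N`, informative (`x₁` has mass 1/2 and a noiseless label, exponent 1), and otherwise nearly
uninformative (exponent `⊤`). Averaged over these configurations, the tasks are independent and each
source sample follows a two-component mixture. The informative component costs affinity only to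
second order in `q` (`one_sub_affinity_mixture_le`): a sample of an informative source is at most `p
^ (-n)` times likelier there than under an uninformative source giving `x₁` mass `p`, so the loss is
of order `q ^ 2 * p ^ (-n)`. The size condition on `NP` makes the total loss per source at most `1 /
(2 * N)` (`Regime.le_affinity_source`). The affinities then multiply to a constant, no test finds
`b`, and since few configurations have too few informative sources (`sum_prior_few_le`), some
admissible one is hard (`exists_error_of_affinity`, `exists_hard_member`).

Upper bound. For each `k`, the samples of the sources among the first `k` tasks are pooled. Relative
deviations hold uniformly over `H` for independent, not identically distributed observations
(`measure_exists_relative_deviation_le`, by swapping with a ghost sample and the Sauer-Shelah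
bound). On the good event the common best classifier is an empirical candidate for the pool, and by
the Bernstein condition each candidate has small average excess risk over the pool
(`average_excessRisk_le_of_goodSamples`). The right `k`, the number of tasks with exponent at most
1, is unknown. The learner picks a classifier that is a candidate for the longest possible range of
pools ending with the full one (`exists_longest_candidate`). The best classifier is a candidate for
all pools from the right `k` on, except with probability `2 / (n * k)`, so the output is then a
candidate at the right `k`. -/

namespace Multisource

/-! ### Affinities of finite distributions -/

/-- The affinity (Bhattacharyya coefficient) of two weight functions on a finite type. -/
noncomputable def affinity {Ω : Type*} [Fintype Ω] (f g : Ω → ℝ) : ℝ :=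
  ∑ ω, √(f ω * g ω)

lemma affinity_nonneg {Ω : Type*} [Fintype Ω] (f g : Ω → ℝ) : 0 ≤ affinity f g :=
  Finset.sum_nonneg fun _ _ => Real.sqrt_nonneg _

/-- Since `f * g = min * max`, Cauchy-Schwarz applies to the roots of minimum and maximum, and the
maxima sum to at most 2. -/
lemma affinity_sq_le {Ω : Type*} [Fintype Ω] {f g : Ω → ℝ} (hf : ∀ ω, 0 ≤ f ω)
    (hg : ∀ ω, 0 ≤ g ω) (hf1 : ∑ ω, f ω = 1) (hg1 : ∑ ω, g ω = 1) :
    affinity f g ^ 2 ≤ 2 * ∑ ω, min (f ω) (g ω) := by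
  have key : affinity f g = ∑ ω, √(min (f ω) (g ω)) * √(max (f ω) (g ω)) := by
    refine Finset.sum_congr rfl fun ω _ => ?_
    rw [← Real.sqrt_mul (le_min (hf ω) (hg ω)), min_mul_max]
  have hmin : ∀ ω, √(min (f ω) (g ω)) ^ 2 = min (f ω) (g ω) :=
    fun ω => Real.sq_sqrt (le_min (hf ω) (hg ω))
  have hmax : ∀ ω, √(max (f ω) (g ω)) ^ 2 = max (f ω) (g ω) :=
    fun ω => Real.sq_sqrt ((hf ω).trans (le_max_left _ _))
  have h0 : 0 ≤ ∑ ω, min (f ω) (g ω) :=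
    Finset.sum_nonneg fun ω _ => le_min (hf ω) (hg ω)
  have h2 : ∑ ω, max (f ω) (g ω) ≤ 2 := by
    calc ∑ ω, max (f ω) (g ω) ≤ ∑ ω, (f ω + g ω) :=
          Finset.sum_le_sum fun ω _ => max_le_add_of_nonneg (hf ω) (hg ω)
      _ = 2 := by rw [Finset.sum_add_distrib, hf1, hg1]; norm_num
  calc affinity f g ^ 2 = (∑ ω, √(min (f ω) (g ω)) * √(max (f ω) (g ω))) ^ 2 := by rw [key]
    _ ≤ (∑ ω, √(min (f ω) (g ω)) ^ 2) * ∑ ω, √(max (f ω) (g ω)) ^ 2 :=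
      Finset.sum_mul_sq_le_sq_mul_sq _ _ _
    _ = (∑ ω, min (f ω) (g ω)) * ∑ ω, max (f ω) (g ω) := by simp only [hmin, hmax]
    _ ≤ 2 * ∑ ω, min (f ω) (g ω) := by nlinarith

/-- The two-point lower bound: no test `d` separates two distributions of large affinity. -/
lemma affinity_sq_le_error {Ω : Type*} [Fintype Ω] {f : Bool → Ω → ℝ} (hf : ∀ b ω, 0 ≤ f b ω)
    (hf1 : ∀ b, ∑ ω, f b ω = 1) (d : Ω → Bool) :
    affinity (f true) (f false) ^ 2 ≤ 2 * ∑ b, ∑ ω, if d ω ≠ b then f b ω else 0 := by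
  refine (affinity_sq_le (hf true) (hf false) (hf1 true) (hf1 false)).trans ?_
  rw [Fintype.sum_bool, ← Finset.sum_add_distrib]
  -- Whatever the test decides at `ω`, exactly one of the two error terms is present, and it is at
  -- least the minimum.
  gcongr with ω
  cases d ω <;> simp

lemma affinity_pi {ι : Type*} [Fintype ι] [DecidableEq ι] {Ω : ι → Type*} [∀ i, Fintype (Ω i)]
    {f g : ∀ i, Ω i → ℝ} (hf : ∀ i ω, 0 ≤ f i ω) (hg : ∀ i ω, 0 ≤ g i ω) :
    affinity (fun ω : ∀ i, Ω i => ∏ i, f i (ω i)) (fun ω => ∏ i, g i (ω i)) =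
      ∏ i, affinity (f i) (g i) := by
  unfold affinity
  rw [Finset.prod_univ_sum, Fintype.piFinset_univ]
  refine Finset.sum_congr rfl fun ω _ => ?_
  rw [← Finset.prod_mul_distrib, Real.sqrt_prod _ fun i _ => mul_nonneg (hf _ _) (hg _ _)]

lemma sum_pi_prod {ι : Type*} [Fintype ι] [DecidableEq ι] {Ω : ι → Type*} [∀ i, Fintype (Ω i)]
    (f : ∀ i, Ω i → ℝ) : ∑ ω : ∀ i, Ω i, ∏ i, f i (ω i) = ∏ i, ∑ ω, f i ω := by
  rw [Finset.prod_univ_sum, Fintype.piFinset_univ]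

/-! ### Pointwise Hellinger and chi-square estimates for mixtures. -/

lemma sq_sub_div_add_le {a b : ℝ} (ha : 0 < a) (hb : 0 < b) :
    (a - b) ^ 2 / (a + b) ≤ 2 * (a + b - 2 * √(a * b)) := by
  rw [div_le_iff₀ (by positivity), Real.sqrt_mul ha.le]
  obtain ⟨x, hx, rfl⟩ : ∃ x, 0 < x ∧ a = x ^ 2 := ⟨√a, Real.sqrt_pos.2 ha, (Real.sq_sqrt ha.le).symm⟩
  obtain ⟨y, hy, rfl⟩ : ∃ y, 0 < y ∧ b = y ^ 2 := ⟨√b, Real.sqrt_pos.2 hb, (Real.sq_sqrt hb.le).symm⟩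
  rw [Real.sqrt_sq hx.le, Real.sqrt_sq hy.le]
  have : 2 * (x ^ 2 + y ^ 2 - 2 * (x * y)) * (x ^ 2 + y ^ 2) - (x ^ 2 - y ^ 2) ^ 2 =
      ((x - y) ^ 2) ^ 2 := by ring
  linarith [sq_nonneg ((x - y) ^ 2)]

/-- The hypotheses ask for `c ≤ M * a` and `d ≤ M * b` only where `c` and `d` do not vanish. -/
lemma sq_add_sq_div_add_le {a b c d M : ℝ} (ha : 0 < a) (hb : 0 < b) (hc : c ^ 2 ≤ M * c * a)
    (hd : d ^ 2 ≤ M * d * b) : (c ^ 2 + d ^ 2) / (a + b) ≤ M * (c + d) := by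
  have hMc : 0 ≤ M * c := nonneg_of_mul_nonneg_left ((sq_nonneg c).trans hc) ha
  have hMd : 0 ≤ M * d := nonneg_of_mul_nonneg_left ((sq_nonneg d).trans hd) hb
  rw [div_le_iff₀ (by positivity)]
  have h1 := mul_nonneg hMc hb.le
  have h2 := mul_nonneg hMd ha.le
  linarith

/-- The geometric mean is at least the harmonic mean, whose gap to the arithmetic mean is the right
side. -/
lemma half_add_sub_sqrt_mul_le {f g : ℝ} (hf : 0 < f) (hg : 0 < g) :
    (f + g) / 2 - √(f * g) ≤ (f - g) ^ 2 / (2 * (f + g)) := by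
  have h1 : 2 * f * g / (f + g) ≤ √(f * g) := by
    apply Real.le_sqrt_of_sq_le
    rw [div_pow, div_le_iff₀ (by positivity)]
    have := mul_nonneg (mul_pos hf hg).le (sq_nonneg (f - g))
    linarith
  have h2 : (f + g) / 2 - 2 * f * g / (f + g) = (f - g) ^ 2 / (2 * (f + g)) := by
    field_simp; ring
  linarith

/-- The gap is controlled by `(f - g) ^ 2 / (f + g)`. In the numerator the second components enter
with the factor `q ^ 2`, and the denominator is at least `(1 - q) * (a + b)`; hence the quadratic
dependence on `q`. The first components give back a Hellinger distance by `sq_sub_div_add_le`. -/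
lemma mixture_gap_le {q M a b c d : ℝ} (hq0 : 0 ≤ q) (hq1 : q < 1) (ha : 0 < a) (hb : 0 < b)
    (hc : 0 ≤ c) (hd : 0 ≤ d) (hMc : c ^ 2 ≤ M * c * a) (hMd : d ^ 2 ≤ M * d * b) :
    ((1 - q) * a + q * c + ((1 - q) * b + q * d)) / 2
      - √(((1 - q) * a + q * c) * ((1 - q) * b + q * d)) ≤
      (1 - q) * (2 * (a + b - 2 * √(a * b))) + q ^ 2 / (1 - q) * (M * (c + d)) := by
  have hq : 0 < 1 - q := by linarith
  set f := (1 - q) * a + q * c with hf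
  set g := (1 - q) * b + q * d with hg
  have hf0 : 0 < f := by positivity
  have hg0 : 0 < g := by positivity
  have h3 : (f - g) ^ 2 ≤ 2 * ((1 - q) ^ 2 * (a - b) ^ 2) + 2 * (q ^ 2 * (c ^ 2 + d ^ 2)) := by
    have e : 2 * ((1 - q) ^ 2 * (a - b) ^ 2) + 2 * (q ^ 2 * (c ^ 2 + d ^ 2)) - (f - g) ^ 2 =
        ((1 - q) * (a - b) - q * (c - d)) ^ 2 + 4 * (q ^ 2 * (c * d)) := by rw [hf, hg]; ring
    have : 0 ≤ 4 * (q ^ 2 * (c * d)) := by positivity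
    linarith [sq_nonneg ((1 - q) * (a - b) - q * (c - d))]
  have h4 : (1 - q) * (a + b) ≤ f + g := by
    rw [hf, hg]
    linarith [mul_nonneg hq0 hc, mul_nonneg hq0 hd]
  calc (f + g) / 2 - √(f * g) ≤ (f - g) ^ 2 / (2 * (f + g)) := half_add_sub_sqrt_mul_le hf0 hg0
    _ ≤ (2 * ((1 - q) ^ 2 * (a - b) ^ 2) + 2 * (q ^ 2 * (c ^ 2 + d ^ 2))) /
        (2 * ((1 - q) * (a + b))) := by gcongr
    _ = (1 - q) * ((a - b) ^ 2 / (a + b)) + q ^ 2 / (1 - q) * ((c ^ 2 + d ^ 2) / (a + b)) := by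
      field_simp
    _ ≤ _ := by
      have := sq_sub_div_add_le ha hb
      have := sq_add_sq_div_add_le ha hb hMc hMd
      gcongr

/-- The affinity of two mixtures with a common weight `q` of the second component. -/
lemma one_sub_affinity_mixture_le {Ω : Type*} [Fintype Ω] {q M : ℝ} (hq0 : 0 ≤ q) (hq1 : q < 1)
    {P Q : Bool → Ω → ℝ} (hP : ∀ b ω, 0 < P b ω) (hQ : ∀ b ω, 0 ≤ Q b ω)
    (hP1 : ∀ b, ∑ ω, P b ω = 1) (hQ1 : ∀ b, ∑ ω, Q b ω = 1)
    (hM : ∀ b ω, Q b ω ^ 2 ≤ M * Q b ω * P b ω) :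
    1 - affinity (fun ω => (1 - q) * P true ω + q * Q true ω)
        (fun ω => (1 - q) * P false ω + q * Q false ω) ≤
      (1 - q) * (4 * (1 - affinity (P true) (P false))) + q ^ 2 / (1 - q) * (2 * M) := by
  have hq : 0 < 1 - q := by linarith
  have point := fun ω => mixture_gap_le hq0 hq1 (hP true ω) (hP false ω) (hQ true ω) (hQ false ω)
    (hM true ω) (hM false ω)
  have tot := Finset.sum_le_sum fun ω (_ : ω ∈ Finset.univ) => point ω
  simp only [Finset.sum_sub_distrib, Finset.sum_add_distrib, ← Finset.sum_div, ← Finset.mul_sum,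
    hP1, hQ1] at tot
  unfold affinity
  linarith

/-! ### The law of one labelled point -/

/-- The weights of the law on `{x₀} ∪ {x₁} × Bool` for which `x₁` has mass `p` and its label
is `b` with probability `(1 + τ) / 2`. -/
noncomputable def labelWeight (p τ : ℝ) (b : Bool) : Option Bool → ℝ
  | none => 1 - p
  | some y => if y = b then p * (1 + τ) / 2 else p * (1 - τ) / 2

lemma sum_labelWeight (p τ : ℝ) (b : Bool) : ∑ k, labelWeight p τ b k = 1 := by
  cases b <;> simp [labelWeight, Fintype.sum_option] <;> ring

lemma labelWeight_nonneg {p τ : ℝ} (hp : 0 ≤ p) (hp1 : p ≤ 1) (hτ : 0 ≤ τ) (hτ1 : τ ≤ 1)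
    (b : Bool) (k : Option Bool) : 0 ≤ labelWeight p τ b k := by
  rcases k with _ | y
  · simpa [labelWeight] using hp1
  · have : 0 ≤ 1 - τ := by linarith
    simp only [labelWeight]; split_ifs <;> positivity

lemma labelWeight_pos {p τ : ℝ} (hp : 0 < p) (hp1 : p < 1) (hτ : 0 ≤ τ) (hτ1 : τ < 1)
    (b : Bool) (k : Option Bool) : 0 < labelWeight p τ b k := by
  rcases k with _ | y
  · simpa [labelWeight] using hp1
  · have : 0 < 1 - τ := by linarith
    simp only [labelWeight]; split_ifs <;> positivity

/-- The affinity is `1 - p + p * √(1 - τ ^ 2)`, and `√x ≥ x` on the unit interval. So `p * τ ^ 2`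
measures what one point tells about the bit. -/
lemma le_affinity_labelWeight {p τ : ℝ} (hp1 : p ≤ 1) (hτ : 0 ≤ τ) (hτ1 : τ ≤ 1) :
    1 - p * τ ^ 2 ≤ affinity (labelWeight p τ true) (labelWeight p τ false) := by
  have h1 : p * (1 - τ ^ 2) / 2 ≤ √(p * (1 + τ) / 2 * (p * (1 - τ) / 2)) := by
    apply Real.le_sqrt_of_sq_le
    have h0 : 0 ≤ 1 - τ ^ 2 := by nlinarith
    nlinarith [mul_nonneg (sq_nonneg p) (mul_nonneg h0 (sq_nonneg τ))]
  have h2 : √((1 - p) * (1 - p)) = 1 - p := Real.sqrt_mul_self (by linarith)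
  simp only [affinity, Fintype.sum_option, Fintype.sum_bool, labelWeight]
  simp only [if_true, Bool.true_eq_false, Bool.false_eq_true, if_false, h2]
  rw [mul_comm (p * (1 - τ) / 2)]
  linarith

lemma le_affinity_labelWeight_iid {p τ : ℝ} (hp : 0 ≤ p) (hp1 : p ≤ 1) (hτ : 0 ≤ τ) (hτ1 : τ ≤ 1)
    (n : ℕ) :
    1 - n * (p * τ ^ 2) ≤ affinity (fun ζ : Fin n → Option Bool => ∏ i, labelWeight p τ true (ζ i))
      (fun ζ => ∏ i, labelWeight p τ false (ζ i)) := by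
  rw [affinity_pi (fun _ => labelWeight_nonneg hp hp1 hτ hτ1 true)
    (fun _ => labelWeight_nonneg hp hp1 hτ hτ1 false), Finset.prod_const, Finset.card_univ,
    Fintype.card_fin]
  have h : p * τ ^ 2 ≤ 1 := by nlinarith [sq_nonneg τ]
  have := one_add_mul_le_pow (a := -(p * τ ^ 2)) (by linarith) n
  calc 1 - n * (p * τ ^ 2) = 1 + n * -(p * τ ^ 2) := by ring
    _ ≤ (1 + -(p * τ ^ 2)) ^ n := this
    _ ≤ _ := by
      gcongr
      · linarith
      · linarith [le_affinity_labelWeight hp1 hτ hτ1]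

/-- Noiseless samples with balanced marginal are dominated by samples of a law for which `x₁` is
rare. -/
lemma labelWeight_half_sq_le {p τ : ℝ} (hp : 0 < p) (hp1 : p ≤ 1 / 2) (hτ : 0 ≤ τ)
    (n : ℕ) (b : Bool) (ζ : Fin n → Option Bool) :
    (∏ i, labelWeight (1 / 2) 1 b (ζ i)) ^ 2 ≤
      (1 / p) ^ n * (∏ i, labelWeight (1 / 2) 1 b (ζ i)) * ∏ i, labelWeight p τ b (ζ i) := by
  have e : (1 / p) ^ n = ∏ _i : Fin n, (1 / p) := by simp
  rw [e, ← Finset.prod_mul_distrib, ← Finset.prod_mul_distrib, ← Finset.prod_pow]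
  refine Finset.prod_le_prod (fun i _ => sq_nonneg _) fun i _ => ?_
  rcases ζ i with _ | y
  · simp only [labelWeight]
    rw [show 1 / p * (1 - 1 / 2) * (1 - p) = (1 - p) / (2 * p) by field_simp; ring,
      le_div_iff₀ (by positivity)]
    nlinarith
  · simp only [labelWeight]
    split_ifs
    · rw [show 1 / p * (1 / 2 * (1 + 1) / 2) * (p * (1 + τ) / 2) = (1 + τ) / 4 by field_simp; ring]
      nlinarith
    -- The noiseless law gives the wrong label weight 0, so both sides vanish.
    · norm_num

/-! ### Excess risks -/

section ExcessRisk

variable {X : Type*} [MeasurableSpace X] {H : Set (X → Bool)} {P : Measure (X × Bool)}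
  {h hs : X → Bool}

lemma bddBelow_range_risk : BddBelow (Set.range fun h' : H => risk P h') :=
  ⟨0, by rintro _ ⟨h', rfl⟩; exact measureReal_nonneg⟩

lemma IsBest.iInf_risk (hb : IsBest H P hs) : ⨅ h' : H, risk P h' = risk P hs := by
  have : Nonempty H := ⟨⟨hs, hb.1⟩⟩
  exact le_antisymm (ciInf_le bddBelow_range_risk (⟨hs, hb.1⟩ : H)) (le_ciInf fun h' => hb.2 _ h'.2)

lemma IsBest.excessRisk_eq (hb : IsBest H P hs) : excessRisk H P h = risk P h - risk P hs := by
  rw [excessRisk, hb.iInf_risk]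

lemma excessRisk_nonneg (hh : h ∈ H) : 0 ≤ excessRisk H P h :=
  sub_nonneg.2 (ciInf_le bddBelow_range_risk (⟨h, hh⟩ : H))

lemma excessRisk_le_one [IsProbabilityMeasure P] (hh : h ∈ H) : excessRisk H P h ≤ 1 := by
  have : Nonempty H := ⟨⟨h, hh⟩⟩
  have h0 : 0 ≤ ⨅ h' : H, risk P h' := le_ciInf fun h' => measureReal_nonneg
  have h1 : risk P h ≤ 1 := measureReal_le_one
  unfold excessRisk
  linarith

end ExcessRisk

/-! ### Finitely supported laws -/

instance : MeasurableSpace (Option Bool) := ⊤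

instance : DiscreteMeasurableSpace (Option Bool) := ⟨fun _ => trivial⟩

/-- The measure on a finite type with given weights. -/
noncomputable def weightMeasure {K : Type*} [Fintype K] [MeasurableSpace K] (w : K → ℝ) :
    Measure K :=
  ∑ k, ENNReal.ofReal (w k) • Measure.dirac k

section WeightMeasure

variable {K : Type*} [Fintype K] [MeasurableSpace K] [DiscreteMeasurableSpace K] {w : K → ℝ}

open Classical in
lemma weightMeasure_apply (S : Set K) :
    weightMeasure w S = ∑ k, if k ∈ S then ENNReal.ofReal (w k) else 0 := by
  simp [weightMeasure, Measure.finsetSum_apply, Set.indicator_apply]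

lemma weightMeasure_singleton (k : K) : weightMeasure w {k} = ENNReal.ofReal (w k) := by
  classical
  simp [weightMeasure_apply]

open Classical in
lemma weightMeasure_real (hw : ∀ k, 0 ≤ w k) (S : Set K) :
    (weightMeasure w).real S = ∑ k, if k ∈ S then w k else 0 := by
  rw [measureReal_def, weightMeasure_apply, ENNReal.toReal_sum (by intro k _; split_ifs <;> simp)]
  refine Finset.sum_congr rfl fun k _ => ?_
  split_ifs <;> simp [hw]

lemma isProbabilityMeasure_weightMeasure (hw : ∀ k, 0 ≤ w k) (h1 : ∑ k, w k = 1) :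
    IsProbabilityMeasure (weightMeasure w) := by
  constructor
  classical
  rw [weightMeasure_apply]
  simp only [Set.mem_univ, if_true]
  rw [← ENNReal.ofReal_sum_of_nonneg fun k _ => hw k, h1, ENNReal.ofReal_one]

end WeightMeasure

-- Reduces the lower bound to finite sums. Only an inequality is available because the failure event
-- of an arbitrary learner need not be measurable: the outer measure under a push-forward dominates
-- the measure of the preimage.
open Classical in
lemma ofReal_sum_le_sampleLaw {X : Type*} [MeasurableSpace X] {K : Type*} [Fintype K]
    [MeasurableSpace K] [DiscreteMeasurableSpace K] {N : ℕ} (pts : K → X × Bool)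
    (w : Fin (N + 1) → K → ℝ) (hw : ∀ t k, 0 ≤ w t k) (hw1 : ∀ t, ∑ k, w t k = 1)
    (P : Fin (N + 1) → ProbabilityMeasure (X × Bool))
    (hP : ∀ t, (P t : Measure (X × Bool)) = (weightMeasure (w t)).map pts)
    (m : Fin (N + 1) → ℕ) (S : Set (Multisample X m)) :
    ENNReal.ofReal (∑ ω : ∀ t, Fin (m t) → K,
      if (fun t i => pts (ω t i)) ∈ S then ∏ t, ∏ i, w t (ω t i) else 0) ≤ sampleLaw P m S := by
  have hpts : Measurable pts := measurable_of_finite _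
  have := fun t => isProbabilityMeasure_weightMeasure (hw t) (hw1 t)
  have := fun t => Measure.isProbabilityMeasure_map (μ := weightMeasure (w t)) hpts.aemeasurable
  set μ : Measure (∀ t, Fin (m t) → K) :=
    Measure.pi fun t => Measure.pi fun _ : Fin (m t) => weightMeasure (w t) with hμ
  have hlaw : sampleLaw P m = μ.map fun ω t i => pts (ω t i) := by
    have h1 : ∀ t, (Measure.pi fun _ : Fin (m t) => weightMeasure (w t)).map
        (fun (ζ : Fin (m t) → K) i => pts (ζ i)) = Measure.pi fun _ => (P t : Measure (X × Bool)) := by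
      intro t
      simp only [hP]
      exact Measure.pi_map_pi fun _ => hpts.aemeasurable
    have : ∀ t, SigmaFinite ((Measure.pi fun _ : Fin (m t) => weightMeasure (w t)).map
        (fun (ζ : Fin (m t) → K) i => pts (ζ i))) := fun t => by rw [h1 t]; infer_instance
    rw [hμ, Measure.pi_map_pi (f := fun t (ζ : Fin (m t) → K) i => pts (ζ i))
      fun t => (measurable_of_finite _).aemeasurable]
    simp only [h1]
    rfl
  rw [hlaw]
  refine le_trans (le_of_eq ?_) (Measure.le_map_apply (measurable_of_finite _).aemeasurable S)
  set T : Finset (∀ t, Fin (m t) → K) := Finset.univ.filter fun ω => (fun t i => pts (ω t i)) ∈ S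
  have hT : ((fun (ω : ∀ t, Fin (m t) → K) t i => pts (ω t i)) ⁻¹' S) = (T : Set _) := by
    ext ω; simp [T]
  rw [hT, ← sum_measure_singleton, ← Finset.sum_filter, ENNReal.ofReal_sum_of_nonneg
    fun ω _ => Finset.prod_nonneg fun t _ => Finset.prod_nonneg fun i _ => hw _ _]
  refine Finset.sum_congr rfl fun ω _ => ?_
  rw [hμ, Measure.pi_singleton, ENNReal.ofReal_prod_of_nonneg
    fun t _ => Finset.prod_nonneg fun i _ => hw _ _]
  refine Finset.prod_congr rfl fun t _ => ?_
  rw [Measure.pi_singleton, ENNReal.ofReal_prod_of_nonneg fun i _ => hw _ _]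
  simp [weightMeasure_singleton]

/-- The labelled points underlying `labelWeight`. -/
def labelPoint {X : Type*} (x₀ x₁ : X) (a₀ : Bool) : Option Bool → X × Bool
  | none => (x₀, a₀)
  | some y => (x₁, y)

/-- The law of a labelled point with weights `labelWeight p τ b`. -/
noncomputable def labelLaw {X : Type*} [MeasurableSpace X] (x₀ x₁ : X) (a₀ : Bool) (p τ : ℝ)
    (b : Bool) : Measure (X × Bool) :=
  (weightMeasure (labelWeight p τ b)).map (labelPoint x₀ x₁ a₀)

section LabelLaw

variable {X : Type*} [MeasurableSpace X] {x₀ x₁ : X} {a₀ b : Bool} {p τ : ℝ} {H : Set (X → Bool)}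
  {h g : X → Bool}

lemma isProbabilityMeasure_labelLaw (hp : 0 ≤ p) (hp1 : p ≤ 1) (hτ : 0 ≤ τ) (hτ1 : τ ≤ 1) :
    IsProbabilityMeasure (labelLaw x₀ x₁ a₀ p τ b) := by
  have := isProbabilityMeasure_weightMeasure (labelWeight_nonneg hp hp1 hτ hτ1 b)
    (sum_labelWeight p τ b)
  exact Measure.isProbabilityMeasure_map (measurable_of_finite _).aemeasurable

lemma measurableSet_ne_label (hh : Measurable h) : MeasurableSet {z : X × Bool | h z.1 ≠ z.2} :=
  (measurableSet_eq_fun (hh.comp measurable_fst) measurable_snd).compl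

lemma measurableSet_ne (hh : Measurable h) (hg : Measurable g) :
    MeasurableSet {z : X × Bool | h z.1 ≠ g z.1} :=
  (measurableSet_eq_fun (hh.comp measurable_fst) (hg.comp measurable_fst)).compl

open Classical in
lemma labelLaw_real (hp : 0 ≤ p) (hp1 : p ≤ 1) (hτ : 0 ≤ τ) (hτ1 : τ ≤ 1) {S : Set (X × Bool)}
    (hS : MeasurableSet S) :
    (labelLaw x₀ x₁ a₀ p τ b).real S =
      (if (x₀, a₀) ∈ S then 1 - p else 0) + (if (x₁, b) ∈ S then p * (1 + τ) / 2 else 0) +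
        (if (x₁, !b) ∈ S then p * (1 - τ) / 2 else 0) := by
  rw [labelLaw, map_measureReal_apply (measurable_of_finite _) hS,
    weightMeasure_real (labelWeight_nonneg hp hp1 hτ hτ1 b)]
  cases b <;> simp [Fintype.sum_option, labelPoint, labelWeight] <;> ring

lemma risk_labelLaw (hp : 0 ≤ p) (hp1 : p ≤ 1) (hτ : 0 ≤ τ) (hτ1 : τ ≤ 1) (hh : Measurable h) :
    risk (labelLaw x₀ x₁ a₀ p τ b) h = (if h x₀ ≠ a₀ then 1 - p else 0) +
      (if h x₁ ≠ b then p * τ else 0) + p * (1 - τ) / 2 := by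
  rw [risk, labelLaw_real hp hp1 hτ hτ1 (measurableSet_ne_label hh)]
  cases b <;> cases hx : h x₁ <;> simp [hx] <;> ring_nf

lemma isBest_labelLaw (hp : 0 ≤ p) (hp1 : p ≤ 1) (hτ : 0 ≤ τ) (hτ1 : τ ≤ 1)
    (hH : ∀ h ∈ H, Measurable h) (hg : g ∈ H) (hg0 : g x₀ = a₀) (hg1 : g x₁ = b) :
    IsBest H (labelLaw x₀ x₁ a₀ p τ b) g := by
  refine ⟨hg, fun h' hh' => ?_⟩
  rw [risk_labelLaw hp hp1 hτ hτ1 (hH g hg), risk_labelLaw hp hp1 hτ hτ1 (hH h' hh')]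
  have h1 : 0 ≤ p * τ := by positivity
  have h2 : 0 ≤ 1 - p := by linarith
  simp only [hg0, hg1, ne_eq, not_true_eq_false, if_false]
  split_ifs <;> linarith

lemma excessRisk_labelLaw (hp : 0 ≤ p) (hp1 : p ≤ 1) (hτ : 0 ≤ τ) (hτ1 : τ ≤ 1)
    (hH : ∀ h ∈ H, Measurable h) (hg : g ∈ H) (hg0 : g x₀ = a₀) (hg1 : g x₁ = b) (hh : h ∈ H) :
    excessRisk H (labelLaw x₀ x₁ a₀ p τ b) h =
      (if h x₀ ≠ a₀ then 1 - p else 0) + (if h x₁ ≠ b then p * τ else 0) := by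
  rw [(isBest_labelLaw hp hp1 hτ hτ1 hH hg hg0 hg1).excessRisk_eq,
    risk_labelLaw hp hp1 hτ hτ1 (hH g hg), risk_labelLaw hp hp1 hτ hτ1 (hH h hh)]
  simp [hg0, hg1]

lemma disagreement_labelLaw (hp : 0 ≤ p) (hp1 : p ≤ 1) (hτ : 0 ≤ τ) (hτ1 : τ ≤ 1)
    (hh : Measurable h) (hg : Measurable g) :
    disagreement (labelLaw x₀ x₁ a₀ p τ b) h g =
      (if h x₀ ≠ g x₀ then 1 - p else 0) + (if h x₁ ≠ g x₁ then p else 0) := by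
  rw [disagreement, labelLaw_real hp hp1 hτ hτ1 (measurableSet_ne hh hg)]
  simp only [Set.mem_ofPred_eq]
  split_ifs <;> ring

/-- Each of `x₀`, `x₁` contributes at most the `β`-th power of the excess risk to the disagreement,
so the constant 2 suffices. A best classifier may differ from `g` at a point where errors cost
nothing; these degenerate cases are treated separately. -/
lemma bernsteinClass_labelLaw {β Cβ : ℝ} (hβ : 0 ≤ β) (hβ1 : β ≤ 1) (hC : 2 ≤ Cβ)
    (hp : 0 ≤ p) (hp1 : p ≤ 1) (hτ : 0 ≤ τ) (hτ1 : τ ≤ 1) (hpτ : p ≤ (p * τ) ^ β)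
    (hH : ∀ h ∈ H, Measurable h) (hg : g ∈ H) (hg0 : g x₀ = a₀) (hg1 : g x₁ = b) :
    BernsteinClass H Cβ β (labelLaw x₀ x₁ a₀ p τ b) := by
  intro hs hbest h hh
  have hgb := isBest_labelLaw hp hp1 hτ hτ1 hH hg hg0 hg1
  have hs0 : excessRisk H (labelLaw x₀ x₁ a₀ p τ b) hs = 0 := by
    rw [hbest.excessRisk_eq, sub_self]
  rw [excessRisk_labelLaw hp hp1 hτ hτ1 hH hg hg0 hg1 hbest.1] at hs0
  rw [excessRisk_labelLaw hp hp1 hτ hτ1 hH hg hg0 hg1 hh,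
    disagreement_labelLaw hp hp1 hτ hτ1 (hH h hh) (hH hs hbest.1)]
  have e1 : 0 ≤ p * τ := by positivity
  have e2 : 0 ≤ 1 - p := by linarith
  set u := (if h x₀ ≠ a₀ then 1 - p else 0) with hu
  set v := (if h x₁ ≠ b then p * τ else 0) with hv
  have hu0 : 0 ≤ u := by rw [hu]; split_ifs <;> linarith
  have hv0 : 0 ≤ v := by rw [hv]; split_ifs <;> linarith
  have hE : 0 ≤ (u + v) ^ β := by positivity
  have h0 : (0:ℝ) ^ β ≤ (u + v) ^ β := Real.rpow_le_rpow le_rfl (by positivity) hβ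
  have f1 : (1 - p) ≤ (1 - p) ^ β := by
    simpa using Real.rpow_le_rpow_of_exponent_ge' e2 (by linarith) hβ hβ1
  have key1 : (if h x₀ ≠ hs x₀ then 1 - p else 0) ≤ (u + v) ^ β := by
    split_ifs with hne
    · by_cases ha : h x₀ = a₀
      · have hsa : hs x₀ ≠ a₀ := fun hc => hne (ha.trans hc.symm)
        have hp0 : 1 - p = 0 := by
          simp only [hsa, ne_eq, not_false_eq_true, if_true] at hs0
          split_ifs at hs0 <;> linarith
        rw [hp0]; exact hE
      · have : u = 1 - p := by simp [hu, ha]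
        refine f1.trans (Real.rpow_le_rpow e2 (by linarith) hβ)
    · exact hE
  have key2 : (if h x₁ ≠ hs x₁ then p else 0) ≤ (u + v) ^ β := by
    split_ifs with hne
    · by_cases ha : h x₁ = b
      · have hsa : hs x₁ ≠ b := fun hc => hne (ha.trans hc.symm)
        have hp0 : p * τ = 0 := by
          simp only [hsa, ne_eq, not_false_eq_true, if_true] at hs0
          split_ifs at hs0 <;> linarith
        -- Here the hypothesis becomes `p ≤ 0 ^ β`, which is consistent with `p > 0` when `β = 0`,
        -- as `0 ^ 0 = 1`.
        rw [hp0] at hpτ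
        exact hpτ.trans h0
      · have : v = p * τ := by simp [hv, ha]
        refine hpτ.trans (Real.rpow_le_rpow e1 (by linarith) hβ)
    · exact hE
  nlinarith

end LabelLaw

/-! ### The lower bound -/

lemma targetRate_pos (β : ℝ) (nD : ℕ) : 0 < targetRate β nD := by
  unfold targetRate
  split_ifs with h
  · norm_num
  · have : (0:ℝ) < nD := by positivity
    positivity

lemma targetRate_le_one (β : ℝ) (nD : ℕ) : targetRate β nD ≤ 1 := by
  unfold targetRate
  split_ifs with h
  · norm_num
  · exact min_le_left _ _

/-- With mass `eD ^ β` and bias `eD ^ (1 - β)` at `x₁`, one target point carries information `eD ^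
(2 - β)`. At `eD = targetRate / 4` the whole target sample carries at most 1/4. -/
lemma mul_targetRate_rpow_le {β : ℝ} (hβ1 : β < 1) (nD : ℕ) :
    nD * (1 / 4 * targetRate β nD) ^ (2 - β) ≤ 1 / 4 := by
  have h2 : 0 < 2 - β := by linarith
  rcases eq_or_ne nD 0 with rfl | h
  · norm_num
  have hn : (0:ℝ) < nD := by positivity
  rw [Real.mul_rpow (by norm_num) (targetRate_pos _ _).le]
  have h4 : (1 / 4 : ℝ) ^ (2 - β) ≤ 1 / 4 := by
    have := Real.rpow_le_rpow_of_exponent_ge (x := 1 / 4) (by norm_num) (by norm_num)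
      (show (1:ℝ) ≤ 2 - β by linarith)
    simpa using this
  have h5 : targetRate β nD ^ (2 - β) ≤ (nD : ℝ)⁻¹ := by
    calc targetRate β nD ^ (2 - β) ≤ ((nD : ℝ) ^ (-(1 / (2 - β)))) ^ (2 - β) := by
          apply Real.rpow_le_rpow (targetRate_pos _ _).le _ h2.le
          simp [targetRate, h]
      _ = (nD : ℝ)⁻¹ := by
          rw [← Real.rpow_mul hn.le, ← Real.rpow_neg_one]
          congr 1
          field_simp
  calc nD * ((1 / 4 : ℝ) ^ (2 - β) * targetRate β nD ^ (2 - β)) ≤ nD * (1 / 4 * (nD : ℝ)⁻¹) := by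
        gcongr
        exact Real.rpow_nonneg (targetRate_pos _ _).le _
    _ = 1 / 4 := by field_simp

/-- The parameters of the uninformative sources. -/
noncomputable def sourceExcess (β : ℝ) (n N : ℕ) : ℝ := (1 / (16 * N * n)) ^ (1 / (2 - β))

/-- With mass `e ^ β / 2` and bias `e ^ (1 - β)` one point carries information `e ^ (2 - β) / 2`;
the last identity makes this 1/32 in total over `N` sources with `n` points each. -/
lemma sourceExcess_props {β : ℝ} (hβ1 : β < 1) {n N : ℕ} (hn : 1 ≤ n) (hN : 1 ≤ N) :
    0 < sourceExcess β n N ∧ sourceExcess β n N < 1 ∧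
      sourceExcess β n N ^ (2 - β) = 1 / (16 * N * n) := by
  have hn' : (1:ℝ) ≤ n := by exact_mod_cast hn
  have hN' : (1:ℝ) ≤ N := by exact_mod_cast hN
  have h2 : 0 < 2 - β := by linarith
  refine ⟨?_, ?_, ?_⟩
  · unfold sourceExcess; positivity
  · apply Real.rpow_lt_one (by positivity) _ (by positivity)
    rw [div_lt_one (by positivity)]
    nlinarith
  · rw [sourceExcess, ← Real.rpow_mul (by positivity), one_div_mul_cancel h2.ne', Real.rpow_one]

lemma Regime.source_numerics {β Cβ : ℝ} {n NP NQ : ℕ} (hR : Regime 1000 1000 β Cβ n NP NQ)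
    {N : ℕ} (hN : N = NP + NQ) {q e : ℝ} (hq : q = NQ / N) (he : e = sourceExcess β n N) :
    (1 - q) * (4 * (n * (e ^ β / 2 * (e ^ (1 - β)) ^ 2))) +
      q ^ 2 / (1 - q) * (2 * (1 / (e ^ β / 2)) ^ n) ≤ 1 / (2 * N) := by
  have hβ1 := hR.beta_lt_one
  have hβ := hR.beta_nonneg
  have h2 : 0 < 2 - β := by linarith
  have hNQ : (1000:ℝ) ≤ NQ := hR.le_NQ
  have hNP : (3:ℝ) * NQ ≤ NP := by exact_mod_cast hR.le_NP
  have hNr : (N:ℝ) = NP + NQ := by rw [hN]; push_cast; ring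
  have hN0 : (0:ℝ) < N := by linarith
  have hn1 : (1:ℝ) ≤ n := by exact_mod_cast hR.one_le_n
  have hN1 : 1 ≤ N := by exact_mod_cast (by linarith : (1:ℝ) ≤ N)
  obtain ⟨he0, he1, hee⟩ := sourceExcess_props hβ1 hR.one_le_n hN1
  rw [← he] at he0 he1 hee
  have hq0 : 0 ≤ q := by rw [hq]; positivity
  have hq4 : q ≤ 1 / 4 := by rw [hq, div_le_iff₀ hN0]; linarith
  have hpτ : e ^ β / 2 * (e ^ (1 - β)) ^ 2 = 1 / (32 * N * n) := by
    have : e ^ β * (e ^ (1 - β)) ^ 2 = e ^ (2 - β) := by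
      rw [← Real.rpow_natCast, ← Real.rpow_mul he0.le, ← Real.rpow_add he0]
      congr 1; push_cast; ring
    rw [div_mul_eq_mul_div, this, hee]
    field_simp
    norm_num
  have first : (1 - q) * (4 * (n * (e ^ β / 2 * (e ^ (1 - β)) ^ 2))) ≤ 1 / (8 * N) := by
    rw [hpτ]
    have e1 : (4 * (n * (1 / (32 * N * n))) : ℝ) = 1 / (8 * N) := by field_simp; norm_num
    rw [e1]
    have : (0:ℝ) ≤ 1 / (8 * N) := by positivity
    nlinarith
  -- The likelihood ratio `(2 / e ^ β) ^ n` grows like `N ^ θ`. The condition `(n + 1) * β < 2` says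
  -- `θ < 1`, and the exponent in `NP_large` is `1 - θ`.
  set θ := β * n / (2 - β) with hθ
  have hθ0 : 0 ≤ θ := by positivity
  have hθ1 : θ ≤ 1 := by
    rw [hθ, div_le_one h2]
    linarith [hR.n_lt]
  have hpow : (1 / (e ^ β / 2)) ^ n ≤ 2 ^ n * (16 * n * (N:ℝ) ^ θ) := by
    have e1 : (1 / (e ^ β / 2)) ^ n = 2 ^ n * (e ^ (-(β * n))) := by
      rw [one_div_div, div_pow, Real.rpow_neg he0.le, Real.rpow_mul he0.le, Real.rpow_natCast]
      rfl
    have e2 : e ^ (-(β * n)) = (16 * n * N : ℝ) ^ θ := by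
      rw [he, sourceExcess, ← Real.rpow_mul (by positivity), one_div, ← Real.rpow_neg_one,
        ← Real.rpow_mul (by positivity)]
      congr 1
      · ring
      · rw [hθ]; field_simp
    rw [e1, e2, Real.mul_rpow (by positivity) hN0.le]
    gcongr
    have h16 : (1:ℝ) ≤ 16 * n := by linarith
    simpa using Real.rpow_le_rpow_of_exponent_le h16 hθ1
  have hlarge : 1000 * (NQ:ℝ) ^ 2 * 2 ^ (15 * n) ≤ (N:ℝ) ^ (1 - θ) := by
    have e1 : (2 - ((n:ℝ) + 1) * β) / (2 - β) = 1 - θ := by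
      rw [hθ]; field_simp; ring
    have := hR.NP_large
    rw [e1] at this
    refine this.trans (Real.rpow_le_rpow (by positivity) (by linarith) (by linarith))
  -- The loss is of order `(NQ / N) ^ 2 * N ^ θ`, up to factors absorbed by `2 ^ (15 * n)`;
  -- `NP_large` trades `NQ ^ 2` for `N ^ (1 - θ)`, leaving `1 / N`.
  have second : q ^ 2 / (1 - q) * (2 * (1 / (e ^ β / 2)) ^ n) ≤ 1 / (8 * N) := by
    have hn2 : (n:ℝ) ≤ 2 ^ n := by exact_mod_cast (Nat.lt_two_pow_self).le
    have hx : (1:ℝ) ≤ 2 ^ n := one_le_pow₀ (by norm_num)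
    have hb : q ^ 2 / (1 - q) ≤ 4 / 3 * ((NQ:ℝ) ^ 2 / N ^ 2) := by
      rw [div_le_iff₀ (by linarith), ← div_pow, ← hq]
      nlinarith [sq_nonneg q]
    have hNN : (N:ℝ) ^ θ * (N:ℝ) ^ (1 - θ) = N := by
      rw [← Real.rpow_add hN0]; simp
    have hNθ : 0 < (N:ℝ) ^ θ := by positivity
    have h15 : (2:ℝ) ^ (15 * n) = (2 ^ n) ^ 15 := by rw [mul_comm, pow_mul]
    set y : ℝ := 2 ^ n with hy
    have hyy : y ^ 2 ≤ y ^ 15 := pow_le_pow_right₀ hx (by norm_num)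
    calc q ^ 2 / (1 - q) * (2 * (1 / (e ^ β / 2)) ^ n)
        ≤ 4 / 3 * ((NQ:ℝ) ^ 2 / N ^ 2) * (2 * (y * (16 * n * (N:ℝ) ^ θ))) := by gcongr
      _ = (128 / 3 * ((NQ:ℝ) ^ 2 * (y * n)) * (N:ℝ) ^ θ) / N ^ 2 := by ring
      _ ≤ (128 / 3 * ((NQ:ℝ) ^ 2 * (y * y)) * (N:ℝ) ^ θ) / N ^ 2 := by gcongr
      _ ≤ (128 / 3 * ((N:ℝ) ^ (1 - θ) / 1000) * (N:ℝ) ^ θ) / N ^ 2 := by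
        gcongr
        rw [h15] at hlarge
        rw [le_div_iff₀ (by norm_num)]
        nlinarith [sq_nonneg (NQ:ℝ)]
      _ = (128 / 3000 * ((N:ℝ) ^ θ * (N:ℝ) ^ (1 - θ))) / N ^ 2 := by ring
      _ ≤ 1 / (8 * N) := by
        rw [hNN, div_le_div_iff₀ (by positivity) (by positivity)]
        nlinarith [mul_pos hN0 hN0]
  calc _ ≤ 1 / (8 * (N:ℝ)) + 1 / (8 * N) := add_le_add first second
    _ ≤ 1 / (2 * N) := by
      rw [← add_div, div_le_div_iff₀ (by positivity) (by positivity)]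
      linarith

/-- The affinity of one source sample, under the prior for which a source is informative with
probability `q`. -/
lemma Regime.le_affinity_source {β Cβ : ℝ} {n NP NQ : ℕ} (hR : Regime 1000 1000 β Cβ n NP NQ)
    {N : ℕ} (hN : N = NP + NQ) {q e : ℝ} (hq : q = NQ / N) (he : e = sourceExcess β n N) :
    1 - 1 / (2 * N) ≤ affinity
      (fun ζ : Fin n → Option Bool =>
        (1 - q) * ∏ i, labelWeight (e ^ β / 2) (e ^ (1 - β)) true (ζ i) +
          q * ∏ i, labelWeight (1 / 2) 1 true (ζ i))
      (fun ζ => (1 - q) * ∏ i, labelWeight (e ^ β / 2) (e ^ (1 - β)) false (ζ i) +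
          q * ∏ i, labelWeight (1 / 2) 1 false (ζ i)) := by
  have hβ1 := hR.beta_lt_one
  have hβ := hR.beta_nonneg
  have hNQ : (1000:ℝ) ≤ NQ := hR.le_NQ
  have hNP : (3:ℝ) * NQ ≤ NP := by exact_mod_cast hR.le_NP
  have hNr : (N:ℝ) = NP + NQ := by rw [hN]; push_cast; ring
  have hN0 : (0:ℝ) < N := by linarith
  have hN1 : 1 ≤ N := by exact_mod_cast (by linarith : (1:ℝ) ≤ N)
  obtain ⟨he0, he1, -⟩ := sourceExcess_props hβ1 hR.one_le_n hN1
  have num := hR.source_numerics hN hq he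
  rw [← he] at he0 he1
  have hq0 : 0 ≤ q := by rw [hq]; positivity
  have hq4 : q ≤ 1 / 4 := by rw [hq, div_le_iff₀ hN0]; linarith
  have hp0 : 0 < e ^ β / 2 := by positivity
  have hp1 : e ^ β / 2 ≤ 1 / 2 := by
    have := Real.rpow_le_one he0.le he1.le hβ
    linarith
  have hτ0 : 0 ≤ e ^ (1 - β) := by positivity
  have hτ1 : e ^ (1 - β) < 1 := Real.rpow_lt_one he0.le he1 (by linarith)
  have hiid := le_affinity_labelWeight_iid hp0.le (by linarith) hτ0 hτ1.le n
  have hsum : ∀ p τ b, ∑ ζ : Fin n → Option Bool, ∏ i, labelWeight p τ b (ζ i) = 1 := by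
    intro p τ b
    rw [sum_pi_prod fun _ => labelWeight p τ b]
    simp only [sum_labelWeight, Finset.prod_const_one]
  have mix := one_sub_affinity_mixture_le hq0 (by linarith : q < 1)
    (P := fun b (ζ : Fin n → Option Bool) => ∏ i, labelWeight (e ^ β / 2) (e ^ (1 - β)) b (ζ i))
    (Q := fun b (ζ : Fin n → Option Bool) => ∏ i, labelWeight (1 / 2) 1 b (ζ i))
    (M := (1 / (e ^ β / 2)) ^ n)
    (fun b ζ => Finset.prod_pos fun i _ => labelWeight_pos hp0 (by linarith) hτ0 hτ1 b _)
    (fun b ζ => Finset.prod_nonneg fun i _ =>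
      labelWeight_nonneg (by norm_num) (by norm_num) (by norm_num) le_rfl b _)
    (fun b => hsum _ _ b) (fun b => hsum _ _ b)
    (fun b ζ => labelWeight_half_sq_le hp0 hp1 hτ0 n b ζ)
  have : (1 - q) * (4 * (1 - affinity
      (fun ζ : Fin n → Option Bool => ∏ i, labelWeight (e ^ β / 2) (e ^ (1 - β)) true (ζ i))
      (fun ζ => ∏ i, labelWeight (e ^ β / 2) (e ^ (1 - β)) false (ζ i)))) ≤
      (1 - q) * (4 * (n * (e ^ β / 2 * (e ^ (1 - β)) ^ 2))) := by
    have : 0 ≤ 1 - q := by linarith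
    gcongr
    linarith
  linarith

/-- A Chernoff bound for the number of informative sources. -/
lemma sum_prior_few_le {N NQ : ℕ} (hNQ : (1000:ℝ) ≤ NQ) (hN : NQ ≤ N) {q : ℝ} (hq : q = NQ / N) :
    ∑ a : Fin (N + 1) → Bool, (∏ t, if a t then q else 1 - q) *
      (if ((Finset.univ.filter fun t : Fin N => a t.castSucc = true).card : ℝ) < NQ / 2
        then 1 else 0) ≤ 1 / 100 := by
  have hNr : (NQ:ℝ) ≤ N := by exact_mod_cast hN
  have hN0 : (0:ℝ) < N := by linarith
  have hq0 : 0 ≤ q := by rw [hq]; positivity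
  have hq1 : q ≤ 1 := by rw [hq, div_le_one hN0]; exact hNr
  -- Exponential Markov with base 1/2. The target also has a coordinate in `a`, which is a dummy and
  -- gets the factor 1.
  have hfew : ∀ a : Fin (N + 1) → Bool,
      (if ((Finset.univ.filter fun t : Fin N => a t.castSucc = true).card : ℝ) < NQ / 2
        then (1:ℝ) else 0) ≤ 2 ^ ((NQ:ℝ) / 2) *
          ∏ t, if t = Fin.last N then 1 else if a t then 1 / 2 else 1 := by
    intro a
    have e1 : (∏ t, if t = Fin.last N then (1:ℝ) else if a t then 1 / 2 else 1) =
        (1 / 2) ^ (Finset.univ.filter fun t : Fin N => a t.castSucc = true).card := by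
      rw [Fin.prod_univ_castSucc]
      simp [(Fin.castSucc_lt_last _).ne, Finset.prod_ite]
    rw [e1]
    set c := (Finset.univ.filter fun t : Fin N => a t.castSucc = true).card
    split_ifs with hc
    · have e2 : (2:ℝ) ^ ((NQ:ℝ) / 2) * (1 / 2) ^ c = 2 ^ ((NQ:ℝ) / 2 - c) := by
        rw [Real.rpow_sub (by norm_num), Real.rpow_natCast, one_div, inv_pow]; rfl
      rw [e2]
      exact Real.one_le_rpow (by norm_num) (by linarith)
    · positivity
  have hsum : ∑ a : Fin (N + 1) → Bool, (∏ t, if a t then q else 1 - q) *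
      (∏ t, if t = Fin.last N then (1:ℝ) else if a t then 1 / 2 else 1) = (1 - q / 2) ^ N := by
    simp_rw [← Finset.prod_mul_distrib]
    rw [sum_pi_prod (fun t (x : Bool) => (if x then q else 1 - q) *
      if t = Fin.last N then (1:ℝ) else if x then 1 / 2 else 1), Fin.prod_univ_castSucc]
    simp only [(Fin.castSucc_lt_last _).ne, if_false, Fintype.sum_bool, if_true, Bool.false_eq_true,
      Finset.prod_const, Finset.card_univ, Fintype.card_fin]
    rw [show q * (1 / 2) + (1 - q) * 1 = 1 - q / 2 by ring]
    ring
  have hexp : (1 - q / 2) ^ N ≤ Real.exp (-(NQ / 2)) := by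
    calc (1 - q / 2) ^ N ≤ Real.exp (-(q / 2)) ^ N := by
          gcongr
          · linarith
          · linarith [Real.add_one_le_exp (-(q / 2))]
      _ = Real.exp (-(NQ / 2)) := by
          rw [← Real.exp_nat_mul, hq]
          congr 1
          field_simp
  calc _ ≤ ∑ a : Fin (N + 1) → Bool, (∏ t, if a t then q else 1 - q) * (2 ^ ((NQ:ℝ) / 2) *
          ∏ t, if t = Fin.last N then 1 else if a t then 1 / 2 else 1) := by
        refine Finset.sum_le_sum fun a _ => mul_le_mul_of_nonneg_left (hfew a) ?_
        exact Finset.prod_nonneg fun t _ => by split_ifs <;> linarith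
    _ = 2 ^ ((NQ:ℝ) / 2) * (1 - q / 2) ^ N := by
        rw [← hsum, Finset.mul_sum]
        exact Finset.sum_congr rfl fun a _ => by ring
    _ ≤ Real.exp (Real.log 2 * (NQ / 2)) * Real.exp (-(NQ / 2)) := by
        rw [Real.rpow_def_of_pos (by norm_num)]
        gcongr
    _ = (Real.exp ((1 - Real.log 2) * (NQ / 2)))⁻¹ := by
        rw [← Real.exp_add, ← Real.exp_neg]; congr 1; ring
    _ ≤ (100:ℝ)⁻¹ := by
        gcongr
        have := Real.log_two_lt_d9
        nlinarith [Real.add_one_le_exp ((1 - Real.log 2) * (NQ / 2))]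
    _ = 1 / 100 := by norm_num

/-- Among three classifiers, some two agree at a point `x₀` and differ at a point `x₁`. -/
lemma exists_agree_differ {X : Type*} {H : Set (X → Bool)} (h3 : 3 ≤ H.encard) :
    ∃ (g : Bool → X → Bool) (x₀ x₁ : X) (a₀ : Bool),
      (∀ b, g b ∈ H) ∧ (∀ b, g b x₀ = a₀) ∧ ∀ b, g b x₁ = b := by
  have pair : ∀ u ∈ H, ∀ v ∈ H, ∀ x₀ x₁ : X, u x₀ = v x₀ → u x₁ ≠ v x₁ →
      ∃ (g : Bool → X → Bool) (x₀ x₁ : X) (a₀ : Bool),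
      (∀ b, g b ∈ H) ∧ (∀ b, g b x₀ = a₀) ∧ ∀ b, g b x₁ = b := by
    intro u hu v hv x₀ x₁ h0 h1
    refine ⟨fun b => if u x₁ = b then u else v, x₀, x₁, u x₀, fun b => ?_, fun b => ?_,
      fun b => ?_⟩
    · dsimp only; split_ifs <;> assumption
    · dsimp only; split_ifs <;> simp [h0]
    · dsimp only
      split_ifs with h
      · exact h
      · cases hb : b <;> cases hu : u x₁ <;> cases hv : v x₁ <;> simp_all
  obtain ⟨T, hT, hT3⟩ := Set.exists_subset_encard_eq h3
  obtain ⟨u, v, w, huv, huw, hvw, rfl⟩ := Set.encard_eq_three.1 hT3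
  have hu : u ∈ H := hT (by simp)
  have hv : v ∈ H := hT (by simp)
  have hw : w ∈ H := hT (by simp)
  obtain ⟨x, hx⟩ := Function.ne_iff.1 huv
  -- With only two labels, `w` agrees at `x` with one of `u`, `v`. That pair is distinct, so it
  -- differs elsewhere.
  by_cases hwx : u x = w x
  · obtain ⟨y, hy⟩ := Function.ne_iff.1 huw
    exact pair u hu w hw x y hwx hy
  · obtain ⟨y, hy⟩ := Function.ne_iff.1 hvw
    refine pair v hv w hw x y ?_ hy
    cases hb : u x <;> cases hu : v x <;> cases hv : w x <;> simp_all

/-- An average form of the lower bound: from the affinity of two mixtures over configurations `a`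
to a configuration for which the test `d` errs. -/
lemma exists_error_of_affinity {Ω A : Type*} [Fintype Ω] [Fintype A] {κ : A → ℝ}
    {w : Bool → A → Ω → ℝ} {good : A → Prop} [DecidablePred good] (hκ : ∀ a, 0 ≤ κ a)
    (hκ1 : ∑ a, κ a = 1) (hw : ∀ b a ω, 0 ≤ w b a ω) (hw1 : ∀ b a, ∑ ω, w b a ω = 1)
    (haff : 3 / 8 ≤ affinity (fun ω => ∑ a, κ a * w true a ω) (fun ω => ∑ a, κ a * w false a ω))
    (hbad : ∑ a, κ a * (if good a then 0 else 1) ≤ 1 / 100) (d : Ω → Bool) :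
    ∃ a b, good a ∧ 1 / 50 ≤ ∑ ω, if d ω ≠ b then w b a ω else 0 := by
  by_contra! hcon
  have herr : ∀ b a, (∑ ω, if d ω ≠ b then w b a ω else 0) ≤ 1 / 50 + if good a then 0 else 1 := by
    intro b a
    by_cases ha : good a
    · simpa [ha] using (hcon a b ha).le
    · have : (∑ ω, if d ω ≠ b then w b a ω else 0) ≤ 1 := by
        rw [← hw1 b a]
        refine Finset.sum_le_sum fun ω _ => ?_
        split_ifs
        · exact le_rfl
        · exact hw _ _ _
      simp only [ha, if_false]
      linarith
  have htest := affinity_sq_le_error (f := fun b ω => ∑ a, κ a * w b a ω)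
    (fun b ω => Finset.sum_nonneg fun a _ => mul_nonneg (hκ a) (hw _ _ _))
    (fun b => by
      rw [Finset.sum_comm]
      simp only [← Finset.mul_sum, hw1, mul_one, hκ1]) d
  have hmix : ∀ b, (∑ ω, if d ω ≠ b then ∑ a, κ a * w b a ω else 0) ≤ 3 / 100 := by
    intro b
    calc (∑ ω, if d ω ≠ b then ∑ a, κ a * w b a ω else 0)
        = ∑ ω, ∑ a, κ a * (if d ω ≠ b then w b a ω else 0) := by
          refine Finset.sum_congr rfl fun ω _ => ?_
          split_ifs <;> simp
      _ = ∑ a, κ a * ∑ ω, (if d ω ≠ b then w b a ω else 0) := by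
          rw [Finset.sum_comm]
          simp only [Finset.mul_sum]
      _ ≤ ∑ a, κ a * (1 / 50 + if good a then 0 else 1) :=
          Finset.sum_le_sum fun a _ => mul_le_mul_of_nonneg_left (herr b a) (hκ a)
      _ = 1 / 50 + ∑ a, κ a * (if good a then 0 else 1) := by
          simp only [mul_add, Finset.sum_add_distrib, ← Finset.sum_mul, hκ1, one_mul]
      _ ≤ 3 / 100 := by linarith
  -- The two-point bound would give squared affinity at most 12/100, below `(3 / 8) ^ 2 = 9 / 64`.
  have h2 : ∑ b, (∑ ω, if d ω ≠ b then ∑ a, κ a * w b a ω else 0) ≤ 6 / 100 := by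
    rw [Fintype.sum_bool]
    linarith [hmix true, hmix false]
  nlinarith [affinity_nonneg (fun ω => ∑ a, κ a * w true a ω) (fun ω => ∑ a, κ a * w false a ω)]

@[simp] lemma sampleSizes_castSucc (N n nD : ℕ) (t : Fin N) :
    sampleSizes N n nD t.castSucc = n := by
  simp [sampleSizes]

@[simp] lemma sampleSizes_last (N n nD : ℕ) : sampleSizes N n nD (Fin.last N) = nD := by
  simp [sampleSizes]

lemma excessRisk_labelLaw_transfer {X : Type*} [MeasurableSpace X] {x₀ x₁ : X} {a₀ b : Bool}
    {p τ : ℝ} {H : Set (X → Bool)} {g : X → Bool} (hp : 0 ≤ p) (hp1 : p ≤ 1) (hτ : 0 ≤ τ)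
    (hτ1 : τ ≤ 1) (hH : ∀ h ∈ H, Measurable h) (hg : g ∈ H) (hg0 : g x₀ = a₀) (hg1 : g x₁ = b) :
    HasTransferExponent H 3 1 (labelLaw x₀ x₁ a₀ (1 / 2) 1 b) (labelLaw x₀ x₁ a₀ p τ b) := by
  intro h hh
  rw [excessRisk_labelLaw hp hp1 hτ hτ1 hH hg hg0 hg1 hh,
    excessRisk_labelLaw (by norm_num) (by norm_num) (by norm_num) le_rfl hH hg hg0 hg1 hh]
  simp only [inv_one, ENNReal.toReal_one, Real.rpow_one]
  have : p * τ ≤ 1 := by nlinarith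
  split_ifs <;> linarith

lemma hasTransferExponent_top {X : Type*} [MeasurableSpace X] {H : Set (X → Bool)}
    (P D : Measure (X × Bool)) [IsProbabilityMeasure D] : HasTransferExponent H 3 ⊤ P D := by
  intro h hh
  simp only [ENNReal.inv_top, ENNReal.toReal_zero, Real.rpow_zero]
  linarith [excessRisk_le_one (P := D) hh]

/-- Every learner fails on some member of some multisource class. -/
theorem exists_hard_member {X : Type*} [MeasurableSpace X] {H : Set (X → Bool)}
    (hH : ∀ h ∈ H, Measurable h) (h3 : 3 ≤ H.encard) {β Cβ : ℝ} {n nD NP NQ : ℕ}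
    (hR : Regime 1000 1000 β Cβ n NP NQ) {N : ℕ} (hN : N = NP + NQ)
    {m : Fin (N + 1) → ℕ} (hm : m = sampleSizes N n nD) (h : Learner H m) :
    ∃ ρ ∈ exponentFamily N NQ, ∃ P ∈ multisourceClass H 3 ρ Cβ β,
      ENNReal.ofReal (1 / 50) ≤ sampleLaw P m
        {z | 1 / 4 * targetRate β nD ≤ excessRisk H (P (Fin.last N)) (h z)} := by
  classical
  obtain ⟨g, x₀, x₁, a₀, hg, hg0, hg1⟩ := exists_agree_differ h3
  have hβ := hR.beta_nonneg
  have hβ1 := hR.beta_lt_one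
  have hNQ : (1000:ℝ) ≤ NQ := hR.le_NQ
  have hNr : (N:ℝ) = NP + NQ := by rw [hN]; push_cast; ring
  have hNQN : (NQ:ℝ) ≤ N := by rw [hNr]; linarith [(Nat.cast_nonneg NP : (0:ℝ) ≤ NP)]
  have hN0 : (0:ℝ) < N := by linarith
  have hN1 : 1 ≤ N := by exact_mod_cast (by linarith : (1:ℝ) ≤ N)
  obtain ⟨q, hq⟩ : ∃ q : ℝ, q = NQ / N := ⟨_, rfl⟩
  have hq0 : 0 ≤ q := by rw [hq]; positivity
  have hq1 : q ≤ 1 := by rw [hq, div_le_one hN0]; exact hNQN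
  -- the parameters of the uninformative sources and of the target
  obtain ⟨e, he⟩ : ∃ e, e = sourceExcess β n N := ⟨_, rfl⟩
  obtain ⟨he0, he1, -⟩ := sourceExcess_props hβ1 hR.one_le_n hN1
  rw [← he] at he0 he1
  have hsource := hR.le_affinity_source hN hq he
  obtain ⟨eD, heD⟩ : ∃ eD, eD = 1 / 4 * targetRate β nD := ⟨_, rfl⟩
  have heD0 : 0 < eD := by rw [heD]; linarith [targetRate_pos β nD]
  have heD1 : eD ≤ 1 := by rw [heD]; linarith [targetRate_le_one β nD]
  have htarget : nD * eD ^ (2 - β) ≤ 1 / 4 := heD ▸ mul_targetRate_rpow_le hβ1 nD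
  have hβ' : 0 ≤ 1 - β := by linarith
  have hmulD : eD ^ β * eD ^ (1 - β) = eD := by
    rw [← Real.rpow_add heD0]; simp
  -- Pairs of mass and bias at `x₁`. The product of the pair is the cost of a wrong label: `eD` for
  -- the target. Halving `e ^ β` keeps the mass at most 1/2 even for `β = 0`, as the comparison with
  -- informative samples needs.
  let par : Fin (N + 1) → Bool → ℝ × ℝ := fun t a =>
    if t = Fin.last N then (eD ^ β, eD ^ (1 - β))
    else if a then (1 / 2, 1) else (e ^ β / 2, e ^ (1 - β))
  have hpar : ∀ t a, 0 ≤ (par t a).1 ∧ (par t a).1 ≤ 1 ∧ 0 ≤ (par t a).2 ∧ (par t a).2 ≤ 1 ∧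
      (par t a).1 ≤ ((par t a).1 * (par t a).2) ^ β := by
    intro t a
    by_cases ht : t = Fin.last N
    · simp only [par, ht, if_true]
      refine ⟨by positivity, Real.rpow_le_one heD0.le heD1 hβ, by positivity,
        Real.rpow_le_one heD0.le heD1 hβ', ?_⟩
      rw [hmulD]
    · simp only [par, ht, if_false]
      have hhalf : (1:ℝ) / 2 ≤ (1 / 2) ^ β := by
        simpa using Real.rpow_le_rpow_of_exponent_ge (x := 1 / 2) (by norm_num) (by norm_num)
          hβ1.le
      cases a
      · simp only [Bool.false_eq_true, if_false]
        have h1 := Real.rpow_le_one he0.le he1.le hβ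
        refine ⟨by positivity, by linarith, by positivity, Real.rpow_le_one he0.le he1.le hβ', ?_⟩
        have hmul : e ^ β / 2 * e ^ (1 - β) = e * (1 / 2) := by
          rw [div_mul_eq_mul_div, ← Real.rpow_add he0]; simp; ring
        rw [hmul, Real.mul_rpow he0.le (by norm_num), div_eq_mul_one_div]
        gcongr
      · simp only [if_true]
        refine ⟨by norm_num, by norm_num, by norm_num, by norm_num, ?_⟩
        rw [mul_one]; exact hhalf
  let comp : Bool → Fin (N + 1) → Bool → Option Bool → ℝ := fun b t a =>
    labelWeight (par t a).1 (par t a).2 b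
  have hcomp : ∀ b t a k, 0 ≤ comp b t a k := fun b t a k =>
    labelWeight_nonneg (hpar t a).1 (hpar t a).2.1 (hpar t a).2.2.1 (hpar t a).2.2.2.1 b k
  let κ : Bool → ℝ := fun a => if a then q else 1 - q
  have hκ : ∀ a, 0 ≤ κ a := fun a => by
    simp only [κ]; split_ifs <;> linarith
  have hκ1 : ∑ a, κ a = 1 := by simp [κ]
  let F : Bool → ∀ t, (Fin (m t) → Option Bool) → ℝ := fun b t ζ =>
    ∑ a, κ a * ∏ i, comp b t a (ζ i)
  have hF : ∀ b t ζ, 0 ≤ F b t ζ := fun b t ζ => Finset.sum_nonneg fun a _ =>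
    mul_nonneg (hκ a) (Finset.prod_nonneg fun i _ => hcomp _ _ _ _)
  -- The prior on configurations is a product, so averaging over it keeps the tasks independent and
  -- affinities multiply.
  have hmix : ∀ b, (fun ω : ∀ t, Fin (m t) → Option Bool => ∑ a : Fin (N + 1) → Bool,
      (∏ t, κ (a t)) * ∏ t, ∏ i, comp b t (a t) (ω t i)) = fun ω => ∏ t, F b t (ω t) := by
    intro b
    ext ω
    simp_rw [← Finset.prod_mul_distrib]
    exact sum_pi_prod fun t a => κ a * ∏ i, comp b t a (ω t i)
  have hafft : ∀ t : Fin N, 1 - 1 / (2 * N) ≤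
      affinity (F true t.castSucc) (F false t.castSucc) := by
    intro t
    have hne : t.castSucc ≠ Fin.last N := (Fin.castSucc_lt_last _).ne
    have hmt : m t.castSucc = n := by simp [hm]
    simp only [F, comp, par, hne, if_false, κ, Fintype.sum_bool, if_true, Bool.false_eq_true]
    rw [hmt]
    refine hsource.trans (le_of_eq ?_)
    congr 1 <;> ext ζ <;> ring
  have haffD : 3 / 4 ≤ affinity (F true (Fin.last N)) (F false (Fin.last N)) := by
    have hmt : m (Fin.last N) = nD := by simp [hm]
    simp only [F, comp, par, if_true, ← Finset.sum_mul, hκ1, one_mul]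
    rw [hmt]
    refine le_trans ?_ (le_affinity_labelWeight_iid (by positivity)
      (Real.rpow_le_one heD0.le heD1 hβ) (by positivity) (Real.rpow_le_one heD0.le heD1 hβ') nD)
    have : eD ^ β * (eD ^ (1 - β)) ^ 2 = eD ^ (2 - β) := by
      rw [← Real.rpow_natCast, ← Real.rpow_mul heD0.le, ← Real.rpow_add heD0]
      congr 1; push_cast; ring
    rw [this]
    linarith
  have haff : 3 / 8 ≤ affinity
      (fun ω : ∀ t, Fin (m t) → Option Bool => ∑ a : Fin (N + 1) → Bool,
        (∏ t, κ (a t)) * ∏ t, ∏ i, comp true t (a t) (ω t i))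
      (fun ω => ∑ a : Fin (N + 1) → Bool,
        (∏ t, κ (a t)) * ∏ t, ∏ i, comp false t (a t) (ω t i)) := by
    rw [hmix, hmix, affinity_pi (hF true) (hF false), Fin.prod_univ_castSucc]
    have h1 : (1 / 2 : ℝ) ≤ ∏ t : Fin N, affinity (F true t.castSucc) (F false t.castSucc) := by
      have h0 : (1:ℝ) / (2 * N) ≤ 1 := by
        rw [div_le_one (by positivity)]; linarith
      calc (1 / 2 : ℝ) = 1 + N * -(1 / (2 * N)) := by field_simp; norm_num
        _ ≤ (1 + -(1 / (2 * N))) ^ N := one_add_mul_le_pow (by linarith) N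
        _ = ∏ _t : Fin N, (1 - 1 / (2 * (N:ℝ))) := by simp [sub_eq_add_neg]
        _ ≤ _ := Finset.prod_le_prod (fun _ _ => by linarith) fun t _ => hafft t
    nlinarith
  have hbad : ∑ a : Fin (N + 1) → Bool, (∏ t, κ (a t)) * (if (NQ:ℝ) / 2 ≤
      ((Finset.univ.filter fun t : Fin N => a t.castSucc = true).card : ℝ) then 0 else 1) ≤
      1 / 100 := by
    refine le_trans (le_of_eq ?_) (sum_prior_few_le hNQ (by exact_mod_cast hNQN) hq)
    refine Finset.sum_congr rfl fun a _ => ?_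
    simp only [← not_le, ite_not, κ]
  -- The test is the label that the learner's output gives to `x₁`.
  obtain ⟨a, b, hgood, herr⟩ := exists_error_of_affinity
    (κ := fun a : Fin (N + 1) → Bool => ∏ t, κ (a t))
    (w := fun b a (ω : ∀ t, Fin (m t) → Option Bool) => ∏ t, ∏ i, comp b t (a t) (ω t i))
    (good := fun a => (NQ:ℝ) / 2 ≤
      ((Finset.univ.filter fun t : Fin N => a t.castSucc = true).card : ℝ))
    (fun a => Finset.prod_nonneg fun t _ => hκ _)
    (by rw [sum_pi_prod fun _ => κ]; simp only [hκ1, Finset.prod_const_one])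
    (fun b a ω => Finset.prod_nonneg fun t _ => Finset.prod_nonneg fun i _ => hcomp _ _ _ _)
    (fun b a => by
      rw [sum_pi_prod fun t (ζ : Fin (m t) → Option Bool) => ∏ i, comp b t (a t) (ζ i)]
      refine Finset.prod_eq_one fun t _ => ?_
      rw [sum_pi_prod fun _ => comp b t (a t)]
      simp only [comp, sum_labelWeight, Finset.prod_const_one])
    haff hbad (fun ω => (h fun t i => labelPoint x₀ x₁ a₀ (ω t i) : X → Bool) x₁)
  have hprob : ∀ t, IsProbabilityMeasure (labelLaw x₀ x₁ a₀ (par t (a t)).1 (par t (a t)).2 b) :=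
    fun t => isProbabilityMeasure_labelLaw (hpar t _).1 (hpar t _).2.1 (hpar t _).2.2.1
      (hpar t _).2.2.2.1
  let P : Fin (N + 1) → ProbabilityMeasure (X × Bool) := fun t => ⟨_, hprob t⟩
  have hP : ∀ t, (P t : Measure (X × Bool)) =
    labelLaw x₀ x₁ a₀ (par t (a t)).1 (par t (a t)).2 b := fun t => rfl
  have hparD : par (Fin.last N) (a (Fin.last N)) = (eD ^ β, eD ^ (1 - β)) := by simp [par]
  -- The class itself depends on the hard configuration: its exponents record which sources are
  -- informative.
  refine ⟨fun t => if a t.castSucc then 1 else ⊤, ⟨fun t => ?_, ?_⟩, P, ⟨⟨g b, fun t => ?_⟩,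
    fun t => ?_, fun t => ?_⟩, ?_⟩
  · dsimp only; split_ifs <;> simp
  · convert hgood using 2
    rw [← Set.ncard_coe_finset]
    congr 1
    ext t
    simp only [Set.mem_ofPred_eq, Finset.coe_filter, Finset.mem_univ, true_and]
    split_ifs with hat <;> simp [hat]
  · exact isBest_labelLaw (hpar t _).1 (hpar t _).2.1 (hpar t _).2.2.1 (hpar t _).2.2.2.1 hH
      (hg b) (hg0 b) (hg1 b)
  · dsimp only
    split_ifs with hat
    · have hne : t.castSucc ≠ Fin.last N := (Fin.castSucc_lt_last _).ne
      have : par t.castSucc (a t.castSucc) = (1 / 2, 1) := by simp [par, hne, hat]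
      rw [hP, hP, this]
      exact excessRisk_labelLaw_transfer (hpar _ _).1 (hpar _ _).2.1 (hpar _ _).2.2.1
        (hpar _ _).2.2.2.1 hH (hg b) (hg0 b) (hg1 b)
    · exact hasTransferExponent_top _ _
  · exact bernsteinClass_labelLaw hβ hβ1.le hR.two_le_Cbeta (hpar t _).1 (hpar t _).2.1
      (hpar t _).2.2.1 (hpar t _).2.2.2.1 (hpar t _).2.2.2.2 hH (hg b) (hg0 b) (hg1 b)
  · refine le_trans (ENNReal.ofReal_le_ofReal (herr.trans ?_))
      (ofReal_sum_le_sampleLaw (labelPoint x₀ x₁ a₀) (fun t => comp b t (a t))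
        (fun t => hcomp b t _) (fun t => sum_labelWeight _ _ _) P hP m _)
    refine Finset.sum_le_sum fun ω _ => ?_
    have hw : 0 ≤ ∏ t, ∏ i, comp b t (a t) (ω t i) :=
      Finset.prod_nonneg fun t _ => Finset.prod_nonneg fun i _ => hcomp _ _ _ _
    by_cases hd : (h fun t i => labelPoint x₀ x₁ a₀ (ω t i) : X → Bool) x₁ = b
    · simp only [hd, ne_eq, not_true_eq_false, if_false]
      split_ifs <;> simp [hw]
    · have hmem : (fun t i => labelPoint x₀ x₁ a₀ (ω t i)) ∈
          {z : Multisample X m | 1 / 4 * targetRate β nD ≤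
            excessRisk H (P (Fin.last N)) (h z)} := by
        rw [Set.mem_ofPred_eq, ← heD, hP,
          excessRisk_labelLaw (hpar _ _).1 (hpar _ _).2.1 (hpar _ _).2.2.1
            (hpar _ _).2.2.2.1 hH (hg b) (hg0 b) (hg1 b) (h _).2, hparD]
        simp only [ne_eq, hd, not_false_eq_true, if_true, hmulD]
        have : eD ^ β ≤ 1 := Real.rpow_le_one heD0.le heD1 hβ
        split_ifs <;> linarith
      simp only [hd, ne_eq, not_false_eq_true, if_true]
      rw [if_pos hmem]

/-! ### Uniform relative deviations for independent observations -/

/-- The exponent of the symmetrized process at one pair of observations. -/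
noncomputable def swapExponent (l a a' : ℝ) : ℝ := l * (a' - a) - l ^ 2 / 2 * (a + a')

/-- This uses `cosh x ≤ exp (x ^ 2 / 2)` and, on the unit interval, `(a' - a) ^ 2 ≤ a + a'`. The
quadratic term of `swapExponent` is thus a variance proxy proportional to the counts, which makes
the deviations relative. -/
lemma exp_swapExponent_add_le (l : ℝ) {a a' : ℝ} (ha : a ∈ Set.Icc (0:ℝ) 1)
    (ha' : a' ∈ Set.Icc (0:ℝ) 1) :
    Real.exp (swapExponent l a a') + Real.exp (swapExponent l a' a) ≤ 2 := by
  have h1 : Real.exp (swapExponent l a a') + Real.exp (swapExponent l a' a) =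
      2 * (Real.cosh (l * (a' - a)) * Real.exp (-(l ^ 2 / 2 * (a + a')))) := by
    rw [Real.cosh_eq, swapExponent, swapExponent, sub_eq_add_neg, Real.exp_add,
      sub_eq_add_neg (l * (a - a')), Real.exp_add,
      show l * (a - a') = -(l * (a' - a)) by ring, add_comm a' a]
    ring
  have h2 : Real.cosh (l * (a' - a)) * Real.exp (-(l ^ 2 / 2 * (a + a'))) ≤ 1 := by
    calc _ ≤ Real.exp ((l * (a' - a)) ^ 2 / 2) * Real.exp (-(l ^ 2 / 2 * (a + a'))) := by
          gcongr
          exact Real.cosh_le_exp_half_sq _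
      _ = Real.exp (l ^ 2 / 2 * ((a' - a) ^ 2 - (a + a'))) := by
          rw [← Real.exp_add]; congr 1; ring
      _ ≤ 1 := by
          rw [Real.exp_le_one_iff]
          apply mul_nonpos_of_nonneg_of_nonpos (by positivity)
          nlinarith [ha.1, ha.2, ha'.1, ha'.2, mul_nonneg ha.1 ha'.1]
  linarith

section Deviation

variable {X : Type*} {H : Set (X → Bool)} {L : ℕ} {c : Bool → X × Bool → ℝ}

/-- The pairs of samples of size `L` on which some member of `H` realizes the pattern `s`. -/
def pairTrace (H : Set (X → Bool)) (s : Fin L → Bool × Bool) :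
    Set (Fin L → (X × Bool) × (X × Bool)) :=
  {w | ∃ h ∈ H, ∀ i, (h (w i).1.1, h (w i).2.1) = s i}

/-- The exponential of the symmetrized process. -/
noncomputable def pairWeight (c : Bool → X × Bool → ℝ) (l : ℝ) (s : Fin L → Bool × Bool)
    (w : Fin L → (X × Bool) × (X × Bool)) : ℝ :=
  Real.exp (∑ i, swapExponent l (c (s i).1 (w i).1) (c (s i).2 (w i).2))

lemma pairWeight_nonneg (c : Bool → X × Bool → ℝ) (l : ℝ) (s : Fin L → Bool × Bool)
    (w : Fin L → (X × Bool) × (X × Bool)) : 0 ≤ pairWeight c l s w :=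
  (Real.exp_pos _).le

/-- Exchange the two entries of a pair if `ε` is true. -/
def condSwap {A : Type*} (ε : Bool) (a : A × A) : A × A := if ε then a.swap else a

lemma condSwap_condSwap {A : Type*} (ε : Bool) (a : A × A) : condSwap ε (condSwap ε a) = a := by
  cases ε <;> simp [condSwap]

lemma condSwap_mem_pairTrace (ε : Fin L → Bool) (s : Fin L → Bool × Bool)
    (w : Fin L → (X × Bool) × (X × Bool)) :
    (fun i => condSwap (ε i) (w i)) ∈ pairTrace H (fun i => condSwap (ε i) (s i)) ↔
      w ∈ pairTrace H s := by
  refine exists_congr fun h => and_congr_right fun _ => forall_congr' fun i => ?_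
  cases hε : ε i
  · simp [condSwap, hε]
  · simp only [condSwap, hε, if_true, Prod.ext_iff, Prod.fst_swap, Prod.snd_swap]
    tauto

lemma sum_pairWeight_condSwap_le (hc : ∀ y z, c y z ∈ Set.Icc (0:ℝ) 1) (l : ℝ)
    (s : Fin L → Bool × Bool) (w : Fin L → (X × Bool) × (X × Bool)) :
    ∑ ε : Fin L → Bool, pairWeight c l (fun i => condSwap (ε i) (s i))
      (fun i => condSwap (ε i) (w i)) ≤ 2 ^ L := by
  simp only [pairWeight, Real.exp_sum]
  rw [sum_pi_prod fun i (e : Bool) => Real.exp (swapExponent l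
    (c (condSwap e (s i)).1 (condSwap e (w i)).1) (c (condSwap e (s i)).2 (condSwap e (w i)).2))]
  calc _ ≤ ∏ _i : Fin L, (2:ℝ) := by
        refine Finset.prod_le_prod (fun i _ => by positivity) fun i _ => ?_
        rw [Fintype.sum_bool, add_comm]
        exact exp_swapExponent_add_le l (hc _ _) (hc _ _)
    _ = 2 ^ L := by simp

-- For fixed `w`, relabelling each pattern along with the swap makes the condition on patterns
-- independent of `ε`. At most `G` patterns remain, and for each the sum over swaps factorizes over
-- `i`.
open Classical in
lemma sum_condSwap_le (hc : ∀ y z, c y z ∈ Set.Icc (0:ℝ) 1) (l : ℝ) {G : ℕ}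
    (w : Fin L → (X × Bool) × (X × Bool))
    (hG : {s : Fin L → Bool × Bool | w ∈ pairTrace H s}.ncard ≤ G) :
    ∑ ε : Fin L → Bool, ∑ s : Fin L → Bool × Bool,
      (pairTrace H s).indicator (fun w => ENNReal.ofReal (pairWeight c l s w))
        (fun i => condSwap (ε i) (w i)) ≤ 2 ^ L * G := by
  have h1 : ∀ ε : Fin L → Bool, ∑ s : Fin L → Bool × Bool,
      (pairTrace H s).indicator (fun w => ENNReal.ofReal (pairWeight c l s w))
        (fun i => condSwap (ε i) (w i)) =
      ∑ s : Fin L → Bool × Bool, if w ∈ pairTrace H s then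
        ENNReal.ofReal (pairWeight c l (fun i => condSwap (ε i) (s i))
          (fun i => condSwap (ε i) (w i))) else 0 := by
    intro ε
    let σ : (Fin L → Bool × Bool) ≃ (Fin L → Bool × Bool) :=
      Function.Involutive.toPerm (fun s i => condSwap (ε i) (s i))
        fun s => funext fun i => condSwap_condSwap _ _
    rw [← Equiv.sum_comp σ]
    refine Finset.sum_congr rfl fun s _ => ?_
    rw [Set.indicator_apply]
    exact if_congr (condSwap_mem_pairTrace ε s w) rfl rfl
  simp only [h1]
  rw [Finset.sum_comm]
  calc _ ≤ ∑ s : Fin L → Bool × Bool, if w ∈ pairTrace H s then (2 ^ L : ℝ≥0∞) else 0 := by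
        refine Finset.sum_le_sum fun s _ => ?_
        split_ifs
        · rw [← ENNReal.ofReal_sum_of_nonneg fun _ _ => pairWeight_nonneg _ _ _ _]
          refine (ENNReal.ofReal_le_ofReal (sum_pairWeight_condSwap_le hc l s w)).trans ?_
          rw [ENNReal.ofReal_pow (by norm_num)]; simp
        · simp
    _ = 2 ^ L * ({s : Fin L → Bool × Bool | w ∈ pairTrace H s}.ncard : ℝ≥0∞) := by
        rw [← Finset.sum_filter, Finset.sum_const, nsmul_eq_mul, mul_comm, ← Set.ncard_coe_finset]
        simp
    _ ≤ 2 ^ L * G := by gcongr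

/-- The empirical count of a classifier. -/
noncomputable def countOf (c : Bool → X × Bool → ℝ) (h : X → Bool) (z : Fin L → X × Bool) : ℝ :=
  ∑ i, c (h (z i).1) (z i)

lemma countOf_mem (hc : ∀ y z, c y z ∈ Set.Icc (0:ℝ) 1) (h : X → Bool) (z : Fin L → X × Bool) :
    countOf c h z ∈ Set.Icc (0:ℝ) L := by
  refine ⟨Finset.sum_nonneg fun i _ => (hc _ _).1, ?_⟩
  calc countOf c h z ≤ ∑ _i : Fin L, (1:ℝ) := Finset.sum_le_sum fun i _ => (hc _ _).2
    _ = L := by simp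

variable [MeasurableSpace X] {Q : Fin L → Measure (X × Bool)}

lemma measurable_pairWeight (hcm : ∀ y, Measurable (c y)) (l : ℝ) (s : Fin L → Bool × Bool) :
    Measurable (pairWeight c l s) := by
  unfold pairWeight swapExponent
  fun_prop

/-- The symmetrization bound. -/
lemma lintegral_sum_indicator_pairTrace_le [∀ i, IsProbabilityMeasure (Q i)]
    (hc : ∀ y z, c y z ∈ Set.Icc (0:ℝ) 1) (hcm : ∀ y, Measurable (c y)) (l : ℝ) {G : ℕ}
    (hG : ∀ w, {s : Fin L → Bool × Bool | w ∈ pairTrace H s}.ncard ≤ G)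
    (hR : ∀ s : Fin L → Bool × Bool,
      NullMeasurableSet (pairTrace H s) (Measure.pi fun i => (Q i).prod (Q i))) :
    ∫⁻ w, ∑ s : Fin L → Bool × Bool,
      (pairTrace H s).indicator (fun w => ENNReal.ofReal (pairWeight c l s w)) w
        ∂(Measure.pi fun i => (Q i).prod (Q i)) ≤ G := by
  classical
  set M := Measure.pi fun i => (Q i).prod (Q i) with hM
  set Ψ : (Fin L → (X × Bool) × (X × Bool)) → ℝ≥0∞ := fun w => ∑ s : Fin L → Bool × Bool,
      (pairTrace H s).indicator (fun w => ENNReal.ofReal (pairWeight c l s w)) w with hΨ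
  have hΨm : AEMeasurable Ψ M := by
    refine Finset.aemeasurable_fun_sum _ fun s _ => ?_
    exact ((measurable_pairWeight hcm l s).ennreal_ofReal.aemeasurable).indicator₀ (hR s)
  have hswap : ∀ ε : Fin L → Bool, MeasurePreserving
      (fun (w : Fin L → (X × Bool) × (X × Bool)) i => condSwap (ε i) (w i)) M M := by
    intro ε
    refine measurePreserving_pi _ _ fun i => ?_
    cases hε : ε i
    · exact MeasurePreserving.id _
    · exact Measure.measurePreserving_swap
  have hint : ∀ ε : Fin L → Bool, ∫⁻ w, Ψ (fun i => condSwap (ε i) (w i)) ∂M = ∫⁻ w, Ψ w ∂M := by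
    intro ε
    conv_rhs => rw [← (hswap ε).map_eq]
    rw [lintegral_map' (by rw [(hswap ε).map_eq]; exact hΨm) (hswap ε).measurable.aemeasurable]
  have htot : (2:ℝ≥0∞) ^ L * ∫⁻ w, Ψ w ∂M ≤ 2 ^ L * G := by
    calc (2:ℝ≥0∞) ^ L * ∫⁻ w, Ψ w ∂M
        = ∑ ε : Fin L → Bool, ∫⁻ w, Ψ (fun i => condSwap (ε i) (w i)) ∂M := by
          simp [hint]
      _ = ∫⁻ w, ∑ ε : Fin L → Bool, Ψ (fun i => condSwap (ε i) (w i)) ∂M := by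
          rw [lintegral_finsetSum' _ fun ε _ => ?_]
          exact hΨm.comp_quasiMeasurePreserving (hswap ε).quasiMeasurePreserving
      _ ≤ ∫⁻ _w, 2 ^ L * G ∂M := lintegral_mono fun w => sum_condSwap_le hc l w (hG w)
      _ = 2 ^ L * G := by simp
  exact (ENNReal.mul_le_mul_iff_right (by simp) (by simp)).1 htot

/-! ### Expected counts and the passage to a ghost sample. -/

/-- The expected count of a classifier. -/
noncomputable def expectedCount (Q : Fin L → Measure (X × Bool)) (c : Bool → X × Bool → ℝ)
    (h : X → Bool) : ℝ :=
  ∑ i, ∫ z, c (h z.1) z ∂Q i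

lemma measurable_label (hcm : ∀ y, Measurable (c y)) {h : X → Bool} (hh : Measurable h) :
    Measurable fun z : X × Bool => c (h z.1) z := by
  have : (fun z : X × Bool => c (h z.1) z) =
      fun z => if h z.1 = true then c true z else c false z := by
    ext z; cases h z.1 <;> simp
  rw [this]
  exact Measurable.ite ((hh.comp measurable_fst) (measurableSet_singleton true)) (hcm _) (hcm _)

lemma measurable_countOf (hcm : ∀ y, Measurable (c y)) {h : X → Bool} (hh : Measurable h) :
    Measurable (countOf (L := L) c h) :=
  Finset.measurable_fun_sum _ fun i _ => (measurable_label hcm hh).comp (measurable_pi_apply i)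

lemma integral_countOf [∀ i, IsProbabilityMeasure (Q i)] (hc : ∀ y z, c y z ∈ Set.Icc (0:ℝ) 1)
    (hcm : ∀ y, Measurable (c y)) {h : X → Bool} (hh : Measurable h) :
    ∫ z, countOf c h z ∂Measure.pi Q = expectedCount Q c h := by
  have hm := measurable_label hcm hh
  unfold countOf expectedCount
  rw [integral_finsetSum]
  · refine Finset.sum_congr rfl fun i _ => ?_
    exact integral_comp_eval (μ := Q) hm.aestronglyMeasurable
  · intro i _
    refine Integrable.of_bound (hm.comp (measurable_pi_apply i)).aestronglyMeasurable 1
      (ae_of_all _ fun z => ?_)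
    rw [Real.norm_eq_abs, abs_le]
    exact ⟨by linarith [(hc (h (z i).1) (z i)).1], (hc _ _).2⟩

lemma exp_mul_expectedCount_le [∀ i, IsProbabilityMeasure (Q i)]
    (hc : ∀ y z, c y z ∈ Set.Icc (0:ℝ) 1) (hcm : ∀ y, Measurable (c y)) {h : X → Bool}
    (hh : Measurable h) (a k : ℝ) :
    ENNReal.ofReal (Real.exp (a + k * expectedCount Q c h)) ≤
      ∫⁻ z, ENNReal.ofReal (Real.exp (a + k * countOf c h z)) ∂Measure.pi Q := by
  have hm := measurable_countOf (L := L) hcm hh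
  have hbd : ∀ z : Fin L → X × Bool, ‖countOf c h z‖ ≤ L := fun z => by
    rw [Real.norm_eq_abs, abs_of_nonneg (countOf_mem hc h z).1]
    exact (countOf_mem hc h z).2
  have hi : Integrable (fun z => a + k * countOf c h z) (Measure.pi Q) :=
    (integrable_const _).add ((Integrable.of_bound hm.aestronglyMeasurable L
      (ae_of_all _ hbd)).const_mul k)
  have hei : Integrable (fun z => Real.exp (a + k * countOf c h z)) (Measure.pi Q) := by
    refine Integrable.of_bound (Real.measurable_exp.comp
      (measurable_const.add (hm.const_mul k))).aestronglyMeasurable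
      (Real.exp (|a| + |k| * L)) (ae_of_all _ fun z => ?_)
    rw [Real.norm_eq_abs, Real.abs_exp, Real.exp_le_exp]
    refine add_le_add (le_abs_self a) ((le_abs_self _).trans ?_)
    rw [abs_mul]
    gcongr
    exact hbd z
  rw [← ofReal_integral_eq_lintegral_ofReal hei (ae_of_all _ fun _ => (Real.exp_pos _).le)]
  refine ENNReal.ofReal_le_ofReal ?_
  have hJ := convexOn_exp.map_integral_le (μ := Measure.pi Q) Real.continuous_exp.continuousOn
    isClosed_univ (ae_of_all _ fun _ => Set.mem_univ _) hi hei
  refine le_trans (le_of_eq ?_) hJ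
  rw [integral_add (integrable_const _) ((Integrable.of_bound hm.aestronglyMeasurable L
      (ae_of_all _ hbd)).const_mul k), integral_const_mul, integral_countOf hc hcm hh]
  simp

/-- The exponential deviation inequality, uniformly over `H`, at one value of the parameter. -/
lemma measure_exists_deviation_le [∀ i, IsProbabilityMeasure (Q i)]
    (hH : ∀ h ∈ H, Measurable h)
    (hc : ∀ y z, c y z ∈ Set.Icc (0:ℝ) 1) (hcm : ∀ y, Measurable (c y)) {G : ℕ}
    (hG : ∀ w, {s : Fin L → Bool × Bool | w ∈ pairTrace H s}.ncard ≤ G)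
    (hR : ∀ s : Fin L → Bool × Bool,
      NullMeasurableSet (pairTrace H s) (Measure.pi fun i => (Q i).prod (Q i))) (l u : ℝ) :
    Measure.pi Q {z | ∃ h ∈ H, u < swapExponent l (countOf c h z) (expectedCount Q c h)} ≤
      G * ENNReal.ofReal (Real.exp (-u)) := by
  classical
  set M := Measure.pi fun i => (Q i).prod (Q i) with hM
  -- The trace sets are only null measurable, and sections of null sets are awkward. Measurable
  -- hulls change no integral and still contain every realized pattern, so Tonelli applies.
  set R' : (Fin L → Bool × Bool) → Set (Fin L → (X × Bool) × (X × Bool)) := fun s =>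
    toMeasurable M (pairTrace H s) with hR'
  set Ψ : (Fin L → (X × Bool) × (X × Bool)) → ℝ≥0∞ := fun w => ∑ s : Fin L → Bool × Bool,
      (R' s).indicator (fun w => ENNReal.ofReal (pairWeight c l s w)) w with hΨ
  have hΨm : Measurable Ψ := Finset.measurable_fun_sum _ fun s _ =>
    (measurable_pairWeight hcm l s).ennreal_ofReal.indicator (measurableSet_toMeasurable _ _)
  have hΨint : ∫⁻ w, Ψ w ∂M ≤ G := by
    refine le_trans (le_of_eq ?_) (lintegral_sum_indicator_pairTrace_le hc hcm l hG hR)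
    refine lintegral_congr_ae ?_
    have : ∀ᵐ w ∂M, ∀ s, (R' s).indicator (fun w => ENNReal.ofReal (pairWeight c l s w)) w =
        (pairTrace H s).indicator (fun w => ENNReal.ofReal (pairWeight c l s w)) w :=
      ae_all_iff.2 fun s => indicator_ae_eq_of_ae_eq_set (hR s).toMeasurable_ae_eq
    filter_upwards [this] with w hw
    exact Finset.sum_congr rfl fun s _ => hw s
  set I : (Fin L → X × Bool) → ℝ≥0∞ := fun z => ∫⁻ z', Ψ (fun i => (z i, z' i)) ∂Measure.pi Q
  have hpair : Measurable fun p : (Fin L → X × Bool) × (Fin L → X × Bool) =>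
      fun i => (p.1 i, p.2 i) := by fun_prop
  have hI : ∫⁻ z, I z ∂Measure.pi Q ≤ G := by
    have hmp := (measurePreserving_arrowProdEquivProdArrow (X × Bool) (X × Bool) (Fin L) Q Q).symm
    rw [← hmp.lintegral_comp hΨm, lintegral_prod] at hΨint
    · exact hΨint
    · exact (hΨm.comp hmp.measurable).aemeasurable
  have hIm : Measurable I := (hΨm.comp hpair).lintegral_prod_right'
  have hsub : {z | ∃ h ∈ H, u < swapExponent l (countOf c h z) (expectedCount Q c h)} ⊆
      {z | ENNReal.ofReal (Real.exp u) ≤ I z} := by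
    rintro z ⟨h, hh, hu⟩
    -- The exponent is affine in the second count, so Jensen replaces the expected count by that of
    -- a ghost sample, with no separate comparison of probabilities.
    have e1 : ∀ x, swapExponent l (countOf c h z) x =
        -(l + l ^ 2 / 2) * countOf c h z + (l - l ^ 2 / 2) * x := fun x => by
      unfold swapExponent; ring
    calc ENNReal.ofReal (Real.exp u)
        ≤ ENNReal.ofReal (Real.exp (swapExponent l (countOf c h z) (expectedCount Q c h))) :=
          ENNReal.ofReal_le_ofReal (Real.exp_le_exp.2 hu.le)
      _ ≤ ∫⁻ z', ENNReal.ofReal (Real.exp (swapExponent l (countOf c h z) (countOf c h z')))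
            ∂Measure.pi Q := by
          simp only [e1]
          exact exp_mul_expectedCount_le hc hcm (hH h hh) _ _
      _ ≤ I z := by
          refine lintegral_mono fun z' => ?_
          set s : Fin L → Bool × Bool := fun i => (h (z i).1, h (z' i).1) with hs
          have hmem : (fun i => (z i, z' i)) ∈ R' s :=
            subset_toMeasurable _ _ ⟨h, hh, fun i => rfl⟩
          have hval : swapExponent l (countOf c h z) (countOf c h z') =
              ∑ i, swapExponent l (c (s i).1 (z i)) (c (s i).2 (z' i)) := by
            simp only [swapExponent, countOf, Finset.sum_sub_distrib, Finset.mul_sum, hs,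
              mul_sub, mul_add, Finset.sum_add_distrib]
          calc ENNReal.ofReal (Real.exp (swapExponent l (countOf c h z) (countOf c h z')))
              = (R' s).indicator (fun w => ENNReal.ofReal (pairWeight c l s w))
                  (fun i => (z i, z' i)) := by
                rw [Set.indicator_of_mem hmem, pairWeight, hval]
            _ ≤ Ψ (fun i => (z i, z' i)) :=
                Finset.single_le_sum (f := fun s => (R' s).indicator
                  (fun w => ENNReal.ofReal (pairWeight c l s w)) (fun i => (z i, z' i)))
                  (fun _ _ => zero_le) (Finset.mem_univ s)
  have hmarkov := mul_meas_ge_le_lintegral (μ := Measure.pi Q) hIm (ENNReal.ofReal (Real.exp u))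
  refine (measure_mono hsub).trans ?_
  rw [Real.exp_neg, ENNReal.ofReal_inv_of_pos (Real.exp_pos u), ← div_eq_mul_inv,
    ENNReal.le_div_iff_mul_le (Or.inl (by simp [Real.exp_pos])) (Or.inl ENNReal.ofReal_ne_top),
    mul_comm]
  exact hmarkov.trans hI

end Deviation

/-! ### The growth function -/

/-- The bound of Sauer and Shelah on the number of traces on `m` points. -/
def growthBound (V m : ℕ) : ℕ := ∑ i ∈ Finset.range (V + 1), m.choose i

lemma one_le_growthBound (V m : ℕ) : 1 ≤ growthBound V m := by
  refine le_trans ?_ (Finset.single_le_sum (f := fun i => m.choose i) (fun _ _ => Nat.zero_le _)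
    (Finset.mem_range.2 (Nat.succ_pos V)))
  simp

/-- Weighting `m.choose i` by `(V / m) ^ i ≥ (V / m) ^ V` and completing the binomial sum gives `(1
+ V / m) ^ m ≤ exp V`. -/
lemma growthBound_le_pow {V m : ℕ} (hV : 1 ≤ V) (hVm : V ≤ m) :
    (growthBound V m : ℝ) ≤ (Real.exp 1 * (m / V)) ^ V := by
  have hV0 : (0:ℝ) < V := by exact_mod_cast hV
  have hm0 : (0:ℝ) < m := by exact_mod_cast hV.trans hVm
  have hr1 : (V:ℝ) / m ≤ 1 := by rw [div_le_one hm0]; exact_mod_cast hVm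
  have hr0 : 0 < (V:ℝ) / m := by positivity
  have key : (growthBound V m : ℝ) * ((V:ℝ) / m) ^ V ≤ Real.exp 1 ^ V := by
    calc (growthBound V m : ℝ) * ((V:ℝ) / m) ^ V
        = ∑ i ∈ Finset.range (V + 1), (m.choose i : ℝ) * ((V:ℝ) / m) ^ V := by
          rw [growthBound]; push_cast; rw [Finset.sum_mul]
      _ ≤ ∑ i ∈ Finset.range (V + 1), (m.choose i : ℝ) * ((V:ℝ) / m) ^ i := by
          refine Finset.sum_le_sum fun i hi => ?_
          gcongr ?_ * ?_
          exact pow_le_pow_of_le_one hr0.le hr1 (Nat.lt_succ_iff.1 (Finset.mem_range.1 hi))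
      _ ≤ ∑ i ∈ Finset.range (m + 1), (m.choose i : ℝ) * ((V:ℝ) / m) ^ i := by
          refine Finset.sum_le_sum_of_subset_of_nonneg ?_ fun i _ _ => by positivity
          exact Finset.range_mono (by omega)
      _ = ((V:ℝ) / m + 1) ^ m := by
          rw [add_pow]
          refine Finset.sum_congr rfl fun i _ => ?_
          rw [one_pow, mul_one, mul_comm]
      _ ≤ Real.exp ((V:ℝ) / m) ^ m := by
          gcongr
          exact Real.add_one_le_exp _
      _ = Real.exp 1 ^ V := by
          rw [← Real.exp_nat_mul, ← Real.exp_nat_mul]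
          congr 1
          field_simp
  have e : (Real.exp 1 * (m / V)) ^ V = Real.exp 1 ^ V / ((V:ℝ) / m) ^ V := by
    rw [← div_pow]; congr 1; field_simp
  rw [e, le_div_iff₀ (by positivity)]
  exact key

lemma card_le_of_shatters {X : Type*} {H : Set (X → Bool)} {V : ℕ} (hV : vcDim H = V)
    {S : Finset X} (hS : Shatters H S) : S.card ≤ V := by
  have : (S.card : ℕ∞) ≤ vcDim H := le_iSup₂_of_le S hS le_rfl
  rw [hV] at this
  exact_mod_cast this

/-- Patterns become a set family on the indices, to which the Sauer-Shelah lemma applies. Points may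
repeat, but `x` is injective on a shattered set of indices, so its image is shattered by `H` and has
the same size. -/
lemma ncard_trace_le {X : Type*} {H : Set (X → Bool)} {V : ℕ} (hV : vcDim H = V)
    {ι : Type*} [Fintype ι] (x : ι → X) :
    {s : ι → Bool | ∃ h ∈ H, ∀ i, h (x i) = s i}.ncard ≤ growthBound V (Fintype.card ι) := by
  classical
  set T := {s : ι → Bool | ∃ h ∈ H, ∀ i, h (x i) = s i} with hT
  set toF : (ι → Bool) → Finset ι := fun s => Finset.univ.filter fun i => s i = true with htoF
  have hinj : Function.Injective toF := by
    intro s s' hss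
    ext i
    have := Finset.ext_iff.1 hss i
    simp only [htoF, Finset.mem_filter, Finset.mem_univ, true_and] at this
    cases h : s i <;> cases h' : s' i <;> simp_all
  set 𝒜 : Finset (Finset ι) := T.toFinite.toFinset.image toF with h𝒜
  have hcard : T.ncard = 𝒜.card := by
    rw [h𝒜, Finset.card_image_of_injective _ hinj, Set.ncard_eq_toFinset_card T T.toFinite]
  have hvc : 𝒜.vcDim ≤ V := by
    refine Finset.sup_le fun S hS => ?_
    rw [Finset.mem_shatterer] at hS
    have key : ∀ t ⊆ S, ∃ h ∈ H, ∀ i ∈ S, h (x i) = true ↔ i ∈ t := by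
      intro t ht
      obtain ⟨a, ha, hat⟩ := hS ht
      obtain ⟨s, hs, rfl⟩ := Finset.mem_image.1 ha
      obtain ⟨h, hh, hhs⟩ := (Set.Finite.mem_toFinset _).1 hs
      refine ⟨h, hh, fun i hi => ?_⟩
      rw [← hat, hhs i]
      simp [htoF, hi]
    have hxinj : Set.InjOn x S := by
      intro i hi j hj hij
      obtain ⟨h, -, hh⟩ := key {i} (by simpa using hi)
      have h1 := (hh i hi).2 (by simp)
      rw [hij] at h1
      simpa [eq_comm] using (hh j hj).1 h1
    rw [← Finset.card_image_of_injOn hxinj]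
    refine card_le_of_shatters hV fun f => ?_
    obtain ⟨h, hh, hhf⟩ := key (S.filter fun i => f (x i) = true) (Finset.filter_subset _ _)
    refine ⟨h, hh, fun y hy => ?_⟩
    obtain ⟨i, hi, rfl⟩ := Finset.mem_image.1 hy
    have := hhf i hi
    simp only [Finset.mem_filter, hi, true_and] at this
    exact Bool.eq_iff_iff.2 this
  rw [hcard]
  refine (𝒜.card_le_card_shatterer.trans Finset.card_shatterer_le_sum_vcDim).trans ?_
  refine Finset.sum_le_sum_of_subset fun i hi => ?_
  have := Finset.mem_Iic.1 hi
  exact Finset.mem_range.2 (by omega)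

lemma ncard_pairTrace_le {X : Type*} {H : Set (X → Bool)} {V L : ℕ} (hV : vcDim H = V)
    (w : Fin L → (X × Bool) × (X × Bool)) :
    {s : Fin L → Bool × Bool | w ∈ pairTrace H s}.ncard ≤ growthBound V (2 * L) := by
  have hcard : Fintype.card (Fin L ⊕ Fin L) = 2 * L := by simp [two_mul]
  rw [← hcard]
  refine le_trans ?_ (ncard_trace_le hV (Sum.elim (fun i => (w i).1.1) (fun i => (w i).2.1)))
  refine Set.ncard_le_ncard_of_injOn
    (fun s => Sum.elim (fun i => (s i).1) (fun i => (s i).2)) ?_ ?_ (Set.toFinite _)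
  · rintro s ⟨h, hh, hs⟩
    refine ⟨h, hh, ?_⟩
    rintro (i | i)
    · simp [← hs i]
    · simp [← hs i]
  · intro s _ s' _ hss
    ext i : 1
    exact Prod.ext (congrFun hss (Sum.inl i)) (congrFun hss (Sum.inr i))

lemma nullMeasurableSet_pairTrace {X : Type*} [MeasurableSpace X] {H : Set (X → Bool)}
    (hT : TraceMeasurable H) {L : ℕ} (s : Fin L → Bool × Bool)
    (M : Measure (Fin L → (X × Bool) × (X × Bool))) [IsProbabilityMeasure M] :
    NullMeasurableSet (pairTrace H s) M := by
  let f : (Fin L → (X × Bool) × (X × Bool)) → (Fin (L + L) → X) := fun w =>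
    Fin.append (fun i => (w i).1.1) (fun i => (w i).2.1)
  have hf : Measurable f := by
    refine measurable_pi_lambda _ fun j => ?_
    refine Fin.addCases (fun i => ?_) (fun i => ?_) j
    · simp only [f, Fin.append_left]; fun_prop
    · simp only [f, Fin.append_right]; fun_prop
  have hp : IsProbabilityMeasure (M.map f) := Measure.isProbabilityMeasure_map hf.aemeasurable
  have h1 := (hT (L + L) (Fin.append (fun i => (s i).1) (fun i => (s i).2)) (M.map f) hp).preimage
    (hf.quasiMeasurePreserving M)
  convert h1 using 1
  ext w
  refine exists_congr fun h => and_congr_right fun _ => ⟨fun hw j => ?_, fun hw i => ?_⟩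
  · refine Fin.addCases (fun i => ?_) (fun i => ?_) j
    · simp only [f, Fin.append_left, ← hw i]
    · simp only [f, Fin.append_right, ← hw i]
  · have h1 := hw (Fin.castAdd L i)
    have h2 := hw (Fin.natAdd L i)
    simp only [f, Fin.append_left, Fin.append_right] at h1 h2
    exact Prod.ext h1 h2

/-! ### The uniform relative deviation inequality -/

/-- The good parameter `√(u / (N + u))` depends on the random count, but counts are integers up to
`L`, so a finite grid contains it. The value `j = 0`, where the parameter is 1, gives the crude
bound `ν ≤ 3 * N + 2 * u`, which makes the quadratic term at most `2 * u` for the good parameter. -/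
lemma abs_sub_le_of_swapExponent_le {L k : ℕ} {N ν u : ℝ} (hu : 0 < u)
    (hk : (k:ℝ) = N) (hkL : k ≤ L)
    (h : ∀ j ≤ L, swapExponent (√(u / (j + u))) N ν ≤ u ∧ swapExponent (-√(u / (j + u))) N ν ≤ u) :
    |ν - N| ≤ 3 * √(u * (N + u)) := by
  have hN : 0 ≤ N := by rw [← hk]; positivity
  have h0 := (h 0 (Nat.zero_le _)).1
  have h1 := h k hkL
  rw [hk] at h1
  have e0 : √(u / ((0:ℕ) + u)) = 1 := by simp [hu.ne']
  rw [e0] at h0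
  unfold swapExponent at h0 h1
  have hν3 : ν ≤ 3 * N + 2 * u := by linarith
  set l := √(u / (N + u)) with hl
  have hl2 : l ^ 2 = u / (N + u) := Real.sq_sqrt (by positivity)
  have hl0 : 0 < l := Real.sqrt_pos.2 (by positivity)
  have hb : l ^ 2 / 2 * (N + ν) ≤ 2 * u := by
    rw [hl2, div_div, div_mul_eq_mul_div, div_le_iff₀ (by positivity)]
    nlinarith
  have habs : l * |ν - N| ≤ 3 * u := by
    rw [← abs_of_pos hl0, ← abs_mul, abs_le]
    constructor
    · have := h1.2
      rw [neg_sq] at this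
      linarith
    · linarith [h1.1]
  have e1 : l * √(u * (N + u)) = u := by
    rw [hl, ← Real.sqrt_mul (by positivity),
      show u / (N + u) * (u * (N + u)) = u * u by field_simp, Real.sqrt_mul_self hu.le]
  have : l * |ν - N| ≤ l * (3 * √(u * (N + u))) := by linarith
  exact le_of_mul_le_mul_left this hl0

section Deviation

variable {X : Type*} [MeasurableSpace X] {H : Set (X → Bool)} {L : ℕ}
  {Q : Fin L → Measure (X × Bool)} {c : Bool → X × Bool → ℝ}

/-- Relative deviations, uniformly over a class of finite dimension. -/
theorem measure_exists_relative_deviation_le [∀ i, IsProbabilityMeasure (Q i)] {V : ℕ}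
    (hH : ∀ h ∈ H, Measurable h) (hT : TraceMeasurable H) (hV : vcDim H = V)
    (hc : ∀ y z, c y z = 0 ∨ c y z = 1) (hcm : ∀ y, Measurable (c y)) {u : ℝ} (hu : 0 < u) :
    Measure.pi Q {z | ∃ h ∈ H, 3 * √(u * (countOf c h z + u)) <
      |expectedCount Q c h - countOf c h z|} ≤
      ENNReal.ofReal (2 * (L + 1) * growthBound V (2 * L) * Real.exp (-u)) := by
  have hc' : ∀ y z, c y z ∈ Set.Icc (0:ℝ) 1 := fun y z => by
    rcases hc y z with h | h <;> simp [h]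
  set S : ℝ → Set (Fin L → X × Bool) := fun l =>
    {z | ∃ h ∈ H, u < swapExponent l (countOf c h z) (expectedCount Q c h)} with hS
  have hSm : ∀ l, Measure.pi Q (S l) ≤ growthBound V (2 * L) * ENNReal.ofReal (Real.exp (-u)) :=
    fun l => measure_exists_deviation_le hH hc' hcm (ncard_pairTrace_le hV)
      (fun s => nullMeasurableSet_pairTrace hT s _) l u
  have hsub : {z | ∃ h ∈ H, 3 * √(u * (countOf c h z + u)) <
      |expectedCount Q c h - countOf c h z|} ⊆
      ⋃ j ∈ Finset.range (L + 1), S (√(u / (j + u))) ∪ S (-√(u / (j + u))) := by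
    rintro z ⟨h, hh, hlt⟩
    by_contra hcon
    simp only [Set.mem_iUnion, Set.mem_union, not_exists, not_or, Finset.mem_range] at hcon
    refine absurd hlt (not_lt.2 ?_)
    obtain ⟨k, hk⟩ : ∃ k : ℕ, (k:ℝ) = countOf c h z := by
      refine ⟨∑ i, if c (h (z i).1) (z i) = 1 then 1 else 0, ?_⟩
      push_cast
      refine Finset.sum_congr rfl fun i _ => ?_
      rcases hc (h (z i).1) (z i) with h0 | h0 <;> simp [h0]
    have hkL : k ≤ L := by
      have := (countOf_mem hc' h z).2
      rw [← hk] at this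
      exact_mod_cast this
    refine abs_sub_le_of_swapExponent_le hu hk hkL fun j hj => ?_
    obtain ⟨h1, h2⟩ := hcon j (Nat.lt_succ_of_le hj)
    exact ⟨not_lt.1 fun hx => h1 ⟨h, hh, hx⟩, not_lt.1 fun hx => h2 ⟨h, hh, hx⟩⟩
  refine ((measure_mono hsub).trans (measure_biUnion_finset_le _ _)).trans ?_
  calc _ ≤ ∑ _j ∈ Finset.range (L + 1),
        2 * (growthBound V (2 * L) * ENNReal.ofReal (Real.exp (-u))) := by
        refine Finset.sum_le_sum fun j _ => (measure_union_le _ _).trans ?_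
        rw [two_mul]
        exact add_le_add (hSm _) (hSm _)
    _ = ENNReal.ofReal (2 * (L + 1) * growthBound V (2 * L) * Real.exp (-u)) := by
        rw [Finset.sum_const, Finset.card_range, nsmul_eq_mul,
          ENNReal.ofReal_mul (by positivity), ENNReal.ofReal_mul (by positivity),
          ENNReal.ofReal_mul (by norm_num), ENNReal.ofReal_natCast]
        have : ENNReal.ofReal ((L:ℝ) + 1) = ((L + 1 : ℕ) : ℝ≥0∞) := by
          rw [← ENNReal.ofReal_natCast]; push_cast; rfl
        rw [this]
        simp only [ENNReal.ofReal_ofNat]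
        ring

end Deviation

/-! ### Candidate classifiers of one aggregated sample -/

section Candidates

variable {X : Type*} {H : Set (X → Bool)} {L : ℕ} {g h : X → Bool}

/-- The number of errors of `h` on a sample. -/
noncomputable def errorCount (h : X → Bool) (z : Fin L → X × Bool) : ℝ :=
  ∑ i, if h (z i).1 ≠ (z i).2 then 1 else 0

/-- The number of sample points at which two classifiers differ. -/
noncomputable def disagreementCount (h h' : X → Bool) (z : Fin L → X × Bool) : ℝ :=
  ∑ i, if h (z i).1 ≠ h' (z i).1 then 1 else 0

/-- The classifiers whose empirical risk is within the deviations of that of every other one. -/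
def candidates (H : Set (X → Bool)) (u : ℝ) (z : Fin L → X × Bool) : Set (X → Bool) :=
  {h ∈ H | ∀ h' ∈ H,
    errorCount h z - errorCount h' z ≤ 6 * √(u * (disagreementCount h h' z + u))}

/-- The indicator of a disagreement with `g`, at the points where `g` is right (`b` is true) or
wrong (`b` is false), as a function of the label assigned by the other classifier. -/
noncomputable def disagreementPart (g : X → Bool) (b y : Bool) (z : X × Bool) : ℝ :=
  if y ≠ g z.1 ∧ (g z.1 = z.2 ↔ b = true) then 1 else 0

lemma disagreementPart_eq (g : X → Bool) (b y : Bool) (z : X × Bool) :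
    disagreementPart g b y z = 0 ∨ disagreementPart g b y z = 1 := by
  unfold disagreementPart
  split_ifs <;> simp

lemma disagreementPart_add (g : X → Bool) (y : Bool) (z : X × Bool) :
    disagreementPart g true y z + disagreementPart g false y z = if y ≠ g z.1 then 1 else 0 := by
  unfold disagreementPart
  cases y <;> cases g z.1 <;> cases z.2 <;> simp

lemma disagreementPart_sub (g : X → Bool) (y : Bool) (z : X × Bool) :
    disagreementPart g true y z - disagreementPart g false y z =
      (if y ≠ z.2 then 1 else 0) - if g z.1 ≠ z.2 then 1 else 0 := by
  unfold disagreementPart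
  cases y <;> cases g z.1 <;> cases z.2 <;> simp

lemma countOf_add (z : Fin L → X × Bool) :
    countOf (disagreementPart g true) h z + countOf (disagreementPart g false) h z =
      disagreementCount h g z := by
  simp only [countOf, disagreementCount, ← Finset.sum_add_distrib, disagreementPart_add]

lemma countOf_sub (z : Fin L → X × Bool) :
    countOf (disagreementPart g true) h z - countOf (disagreementPart g false) h z =
      errorCount h z - errorCount g z := by
  simp only [countOf, errorCount, ← Finset.sum_sub_distrib, disagreementPart_sub]

lemma disagreementCount_comm (z : Fin L → X × Bool) :
    disagreementCount h g z = disagreementCount g h z := by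
  simp only [disagreementCount, ne_comm]

variable [MeasurableSpace X] {Q : Fin L → Measure (X × Bool)}

lemma measurable_disagreementPart (hg : Measurable g) (b y : Bool) :
    Measurable (disagreementPart g b y) := by
  have h1 : Measurable fun z : X × Bool => g z.1 := hg.comp measurable_fst
  have : disagreementPart g b y =
      (fun p : Bool × Bool => if y ≠ p.1 ∧ (p.1 = p.2 ↔ b = true) then (1:ℝ) else 0) ∘
        fun z : X × Bool => (g z.1, z.2) := rfl
  rw [this]
  exact (measurable_of_finite _).comp (h1.prodMk measurable_snd)

lemma integrable_disagreementPart (hg : Measurable g) (hh : Measurable h) (b : Bool)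
    (P : Measure (X × Bool)) [IsProbabilityMeasure P] :
    Integrable (fun z => disagreementPart g b (h z.1) z) P := by
  refine Integrable.of_bound
    (measurable_label (measurable_disagreementPart hg b) hh).aestronglyMeasurable 1
    (ae_of_all _ fun z => ?_)
  rcases disagreementPart_eq g b (h z.1) z with h | h <;> simp [h]

lemma integral_ite_one {P : Measure (X × Bool)} {p : X × Bool → Prop} [DecidablePred p]
    (hp : MeasurableSet {z | p z}) : ∫ z, (if p z then (1:ℝ) else 0) ∂P = P.real {z | p z} := by
  rw [← integral_indicator_one hp]
  refine integral_congr_ae (ae_of_all _ fun z => ?_)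
  simp [Set.indicator_apply]

lemma expectedCount_add [∀ i, IsProbabilityMeasure (Q i)] (hg : Measurable g)
    (hh : Measurable h) :
    expectedCount Q (disagreementPart g true) h + expectedCount Q (disagreementPart g false) h =
      ∑ i, disagreement (Q i) h g := by
  simp only [expectedCount, ← Finset.sum_add_distrib]
  refine Finset.sum_congr rfl fun i _ => ?_
  rw [← integral_add (integrable_disagreementPart hg hh _ _)
    (integrable_disagreementPart hg hh _ _)]
  simp only [disagreementPart_add]
  exact integral_ite_one (measurableSet_ne hh hg)

lemma expectedCount_sub [∀ i, IsProbabilityMeasure (Q i)] (hg : Measurable g)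
    (hh : Measurable h) :
    expectedCount Q (disagreementPart g true) h - expectedCount Q (disagreementPart g false) h =
      ∑ i, (risk (Q i) h - risk (Q i) g) := by
  have hint : ∀ {k : X → Bool}, Measurable k → ∀ i,
      Integrable (fun z : X × Bool => if k z.1 ≠ z.2 then (1:ℝ) else 0) (Q i) := by
    intro k hk i
    refine Integrable.of_bound (Measurable.ite (measurableSet_ne_label hk) measurable_const
      measurable_const).aestronglyMeasurable 1 (ae_of_all _ fun z => ?_)
    split_ifs <;> simp
  simp only [expectedCount, ← Finset.sum_sub_distrib]
  refine Finset.sum_congr rfl fun i _ => ?_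
  rw [← integral_sub (integrable_disagreementPart hg hh _ _)
    (integrable_disagreementPart hg hh _ _)]
  simp only [disagreementPart_sub]
  rw [integral_sub (hint hh i) (hint hg i), integral_ite_one (measurableSet_ne_label hh),
    integral_ite_one (measurableSet_ne_label hg)]
  rfl

/-- The samples on which the relative deviations from `g` are controlled. -/
def goodSamples (H : Set (X → Bool)) (Q : Fin L → Measure (X × Bool)) (g : X → Bool) (u : ℝ) :
    Set (Fin L → X × Bool) :=
  {z | ∀ b, ∀ h ∈ H, |expectedCount Q (disagreementPart g b) h - countOf (disagreementPart g b) h z|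
    ≤ 3 * √(u * (countOf (disagreementPart g b) h z + u))}

lemma measure_compl_goodSamples_le [∀ i, IsProbabilityMeasure (Q i)] {V : ℕ}
    (hH : ∀ h ∈ H, Measurable h) (hT : TraceMeasurable H) (hV : vcDim H = V) (hg : Measurable g)
    {u : ℝ} (hu : 0 < u) :
    Measure.pi Q (goodSamples H Q g u)ᶜ ≤
      ENNReal.ofReal (4 * (L + 1) * growthBound V (2 * L) * Real.exp (-u)) := by
  set B : Bool → Set (Fin L → X × Bool) := fun b => {z | ∃ h ∈ H,
    3 * √(u * (countOf (disagreementPart g b) h z + u)) <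
      |expectedCount Q (disagreementPart g b) h - countOf (disagreementPart g b) h z|} with hB
  have hBm : ∀ b, Measure.pi Q (B b) ≤
      ENNReal.ofReal (2 * (L + 1) * growthBound V (2 * L) * Real.exp (-u)) := fun b =>
    measure_exists_relative_deviation_le hH hT hV (disagreementPart_eq g b)
      (measurable_disagreementPart hg b) hu
  have hsub : (goodSamples H Q g u)ᶜ ⊆ B true ∪ B false := by
    intro z hz
    simp only [goodSamples, Set.mem_compl_iff, Set.mem_ofPred_eq, not_forall, not_le] at hz
    obtain ⟨b, h, hh, hlt⟩ := hz
    cases b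
    · exact Or.inr ⟨h, hh, hlt⟩
    · exact Or.inl ⟨h, hh, hlt⟩
  refine (measure_mono hsub).trans ((measure_union_le _ _).trans ?_)
  refine (add_le_add (hBm true) (hBm false)).trans (le_of_eq ?_)
  rw [← ENNReal.ofReal_add (by positivity) (by positivity)]
  congr 1; ring

/-- The disagreement with `g` is split according to whether `g` is right. The difference of the two
counts is the excess number of errors, their sum the disagreement, so relative deviations of both
parts give a deviation of the excess at the scale of the disagreement. -/
lemma abs_sub_le_of_goodSamples [∀ i, IsProbabilityMeasure (Q i)] (hg : Measurable g)
    (hh : Measurable h) (hhH : h ∈ H) {u : ℝ} (hu : 0 < u) {z : Fin L → X × Bool}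
    (hz : z ∈ goodSamples H Q g u) :
    |∑ i, (risk (Q i) h - risk (Q i) g) - (errorCount h z - errorCount g z)| ≤
      6 * √(u * (disagreementCount h g z + u)) ∧
    disagreementCount h g z ≤ 2 * ∑ i, disagreement (Q i) h g + 20 * u := by
  have hA := hz true h hhH
  have hB := hz false h hhH
  rw [← expectedCount_sub hg hh, ← countOf_sub, ← expectedCount_add hg hh, ← countOf_add]
  have hc : ∀ b, 0 ≤ countOf (disagreementPart g b) h z := fun b =>
    Finset.sum_nonneg fun i _ => by
      rcases disagreementPart_eq g b (h (z i).1) (z i) with h | h <;> simp [h]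
  have hA0 := hc true
  have hB0 := hc false
  set A := countOf (disagreementPart g true) h z
  set B := countOf (disagreementPart g false) h z
  set A' := expectedCount Q (disagreementPart g true) h
  set B' := expectedCount Q (disagreementPart g false) h
  -- The constants are such that `(x / 6 + 5 / 3 * u) ^ 2 - u * (x + u)` is the square `(x / 6 - 4 /
  -- 3 * u) ^ 2`.
  have lin : ∀ x ≥ 0, 3 * √(u * (x + u)) ≤ x / 2 + 5 * u := by
    intro x hx
    have : √(u * (x + u)) ≤ x / 6 + 5 / 3 * u := by
      apply Real.sqrt_le_iff.2 ⟨by positivity, ?_⟩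
      nlinarith [sq_nonneg (x / 6 - 4 / 3 * u), mul_pos hu hu, mul_nonneg hu.le hx]
    linarith
  have mA : √(u * (A + u)) ≤ √(u * (A + B + u)) := Real.sqrt_le_sqrt (by nlinarith)
  have mB : √(u * (B + u)) ≤ √(u * (A + B + u)) := Real.sqrt_le_sqrt (by nlinarith)
  have lA := lin A hA0
  have lB := lin B hB0
  rw [abs_le] at hA hB
  refine ⟨?_, ?_⟩
  · rw [abs_le]
    constructor <;> linarith
  · linarith

/-- The total excess risk over `g` is nonnegative, so the empirical excess over `g` cannot fall
below minus the deviation. -/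
lemma mem_candidates_of_goodSamples [∀ i, IsProbabilityMeasure (Q i)]
    (hH : ∀ h ∈ H, Measurable h) (hg : ∀ i, IsBest H (Q i) g) (hgH : g ∈ H) {u : ℝ} (hu : 0 < u)
    {z : Fin L → X × Bool} (hz : z ∈ goodSamples H Q g u) : g ∈ candidates H u z := by
  refine ⟨hgH, fun h hh => ?_⟩
  have h1 := (abs_sub_le_of_goodSamples (hH g hgH) (hH h hh) hh hu hz).1
  have h2 : 0 ≤ ∑ i, (risk (Q i) h - risk (Q i) g) :=
    Finset.sum_nonneg fun i _ => sub_nonneg.2 ((hg i).2 h hh)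
  rw [abs_le] at h1
  rw [disagreementCount_comm]
  linarith

lemma sum_excessRisk_le_of_goodSamples [∀ i, IsProbabilityMeasure (Q i)]
    (hH : ∀ h ∈ H, Measurable h) (hg : ∀ i, IsBest H (Q i) g) (hgH : g ∈ H) {u : ℝ} (hu : 0 < u)
    {z : Fin L → X × Bool} (hz : z ∈ goodSamples H Q g u) (hh : h ∈ candidates H u z) :
    ∑ i, excessRisk H (Q i) h ≤ 12 * √(u * (2 * ∑ i, disagreement (Q i) h g + 21 * u)) := by
  obtain ⟨h1, h2⟩ := abs_sub_le_of_goodSamples (hH g hgH) (hH h hh.1) hh.1 hu hz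
  have h3 := hh.2 g hgH
  have h4 : √(u * (disagreementCount h g z + u)) ≤
      √(u * (2 * ∑ i, disagreement (Q i) h g + 21 * u)) := by
    exact Real.sqrt_le_sqrt (mul_le_mul_of_nonneg_left (by linarith) hu.le)
  have h5 : ∑ i, excessRisk H (Q i) h = ∑ i, (risk (Q i) h - risk (Q i) g) :=
    Finset.sum_congr rfl fun i _ => (hg i).excessRisk_eq
  rw [abs_le] at h1
  rw [h5]
  linarith

/-! ### Rates from the Bernstein condition -/

/-- Solves the fixed-point inequality of the Bernstein condition. If the term `C * E ^ β` dominates,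
then `E ^ (2 - β) ≤ 432 * (C * ε)` with `432 = 144 * 3`. Otherwise `E` is of order `ε`, since `144 *
63 ≤ 96 ^ 2`, and this is of lower order when `C * ε ≤ 1`. -/
lemma le_rpow_of_le_sqrt {E ε C β : ℝ} (hE : 0 ≤ E) (hE1 : E ≤ 1) (hε : 0 < ε) (hC : 1 ≤ C)
    (hβ1 : β < 1) (h : E ≤ 12 * √(ε * (2 * (C * E ^ β) + 21 * ε))) :
    E ≤ 432 * (C * ε) ^ (1 / (2 - β)) := by
  have h2 : 0 < 2 - β := by linarith
  have hr0 : 0 < 1 / (2 - β) := by positivity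
  have hr1 : 1 / (2 - β) ≤ 1 := by rw [div_le_one h2]; linarith
  rcases hE.eq_or_lt with rfl | hE0
  · positivity
  rcases le_total 1 (C * ε) with h1 | h1
  · have := Real.one_le_rpow h1 hr0.le
    linarith
  have hsq : E ^ 2 ≤ 144 * (ε * (2 * (C * E ^ β) + 21 * ε)) := by
    have := pow_le_pow_left₀ hE h 2
    rw [mul_pow, Real.sq_sqrt (by positivity)] at this
    linarith
  rcases le_total (21 * ε) (C * E ^ β) with hc | hc
  · have hE2 : E ^ (2 - β) ≤ 432 * (C * ε) := by
      rw [Real.rpow_sub hE0, div_le_iff₀ (by positivity), Real.rpow_two]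
      nlinarith [mul_le_mul_of_nonneg_left hc hε.le]
    calc E = (E ^ (2 - β)) ^ (1 / (2 - β)) := by
          rw [← Real.rpow_mul hE, mul_one_div_cancel h2.ne', Real.rpow_one]
      _ ≤ (432 * (C * ε)) ^ (1 / (2 - β)) := by gcongr
      _ = 432 ^ (1 / (2 - β)) * (C * ε) ^ (1 / (2 - β)) := by
          rw [Real.mul_rpow (by norm_num) (by positivity)]
      _ ≤ 432 * (C * ε) ^ (1 / (2 - β)) := by
          gcongr
          simpa using Real.rpow_le_rpow_of_exponent_le (by norm_num : (1:ℝ) ≤ 432) hr1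
  · have hE2 : E ≤ 96 * ε := by
      apply le_of_sq_le_sq _ (by positivity)
      nlinarith [mul_le_mul_of_nonneg_left hc hε.le]
    have h3 : C * ε ≤ (C * ε) ^ (1 / (2 - β)) := by
      simpa using Real.rpow_le_rpow_of_exponent_ge (by positivity) h1 hr1
    have h4 : ε ≤ C * ε := by nlinarith
    have h5 : 0 ≤ (C * ε) ^ (1 / (2 - β)) := by positivity
    linarith

lemma sum_rpow_le {L : ℕ} (hL : 1 ≤ L) {β : ℝ} (hβ : 0 ≤ β) (hβ1 : β ≤ 1) {E : Fin L → ℝ}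
    (hE : ∀ i, 0 ≤ E i) : ∑ i, E i ^ β ≤ L * ((∑ i, E i) / L) ^ β := by
  have hL0 : (0:ℝ) < L := by exact_mod_cast hL
  have := (Real.concaveOn_rpow hβ hβ1).le_map_sum (t := Finset.univ) (w := fun _ : Fin L => 1 / (L:ℝ))
    (p := E) (fun _ _ => by positivity) (by simp [hL0.ne']) (fun i _ => hE i)
  simp only [smul_eq_mul, ← Finset.mul_sum] at this
  rw [one_div_mul_eq_div, one_div_mul_eq_div, div_le_iff₀ hL0] at this
  linarith

/-- The laws differ, so the Bernstein bounds are averaged; concavity of the `β`-th power yields the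
same condition for the average excess risk. -/
lemma average_excessRisk_le_of_goodSamples [∀ i, IsProbabilityMeasure (Q i)]
    (hH : ∀ h ∈ H, Measurable h) (hg : ∀ i, IsBest H (Q i) g) (hgH : g ∈ H) {u : ℝ} (hu : 0 < u)
    (hL : 1 ≤ L) {β Cβ : ℝ} (hβ : 0 ≤ β) (hβ1 : β < 1) (hC : 1 ≤ Cβ)
    (hB : ∀ i, BernsteinClass H Cβ β (Q i))
    {z : Fin L → X × Bool} (hz : z ∈ goodSamples H Q g u) (hh : h ∈ candidates H u z) :
    (∑ i, excessRisk H (Q i) h) / L ≤ 432 * (Cβ * (u / L)) ^ (1 / (2 - β)) := by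
  have hL0 : (0:ℝ) < L := by exact_mod_cast hL
  have hE0 : ∀ i, 0 ≤ excessRisk H (Q i) h := fun i => excessRisk_nonneg hh.1
  have hsum := sum_excessRisk_le_of_goodSamples hH hg hgH hu hz hh
  have hdis : ∑ i, disagreement (Q i) h g ≤
      Cβ * (L * ((∑ i, excessRisk H (Q i) h) / L) ^ β) := by
    calc ∑ i, disagreement (Q i) h g ≤ ∑ i, Cβ * excessRisk H (Q i) h ^ β :=
          Finset.sum_le_sum fun i _ => hB i g (hg i) h hh.1
      _ = Cβ * ∑ i, excessRisk H (Q i) h ^ β := by rw [Finset.mul_sum]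
      _ ≤ _ := by
          gcongr
          exact sum_rpow_le hL hβ hβ1.le hE0
  set S := ∑ i, excessRisk H (Q i) h with hS
  have hS0 : 0 ≤ S := Finset.sum_nonneg fun i _ => hE0 i
  have hS1 : S ≤ L := by
    calc S ≤ ∑ _i : Fin L, (1:ℝ) := Finset.sum_le_sum fun i _ => excessRisk_le_one hh.1
      _ = L := by simp
  refine le_rpow_of_le_sqrt (by positivity) ((div_le_one hL0).2 hS1) (by positivity) hC hβ1 ?_
  rw [div_le_iff₀ hL0]
  refine hsum.trans ?_
  rw [mul_assoc]
  gcongr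
  refine le_of_sq_le_sq ?_ (by positivity)
  rw [mul_pow, Real.sq_sqrt, Real.sq_sqrt (by positivity)]
  · calc u * (2 * ∑ i, disagreement (Q i) h g + 21 * u)
        ≤ u * (2 * (Cβ * (L * (S / L) ^ β)) + 21 * u) := by gcongr
      _ = _ := by field_simp
  · have : 0 ≤ ∑ i, disagreement (Q i) h g := Finset.sum_nonneg fun i _ => measureReal_nonneg
    positivity

end Candidates

/-! ### Aggregated samples -/

/-- Distinct coordinates of a nested product law are independent. -/
lemma map_pi_pi_eval {Z τ κ : Type*} [MeasurableSpace Z] [Fintype τ] [Fintype κ] {m : τ → ℕ}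
    (μ : τ → Measure Z) [∀ t, IsProbabilityMeasure (μ t)] (idx : κ → Σ t, Fin (m t))
    (hidx : Function.Injective idx) :
    (Measure.pi fun t => Measure.pi fun _ : Fin (m t) => μ t).map
      (fun (z : ∀ t, Fin (m t) → Z) j => z (idx j).1 (idx j).2) =
      Measure.pi fun j => μ (idx j).1 := by
  classical
  refine (Measure.pi_eq fun s hs => ?_).symm
  have hmeas : Measurable fun (z : ∀ t, Fin (m t) → Z) j => z (idx j).1 (idx j).2 :=
    measurable_pi_lambda _ fun j => (measurable_pi_apply _).comp (measurable_pi_apply _)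
  rw [Measure.map_apply hmeas (MeasurableSet.univ_pi hs)]
  -- The box `s` is extended to all coordinates by the whole space; injectivity of `idx` makes the
  -- choice unambiguous.
  let B : (Σ t, Fin (m t)) → Set Z := fun p => if h : ∃ j, idx j = p then s h.choose else Set.univ
  have hB : ∀ j, B (idx j) = s j := fun j => by
    have h : ∃ j', idx j' = idx j := ⟨j, rfl⟩
    simp only [B, h, dite_true]
    rw [hidx h.choose_spec]
  have hB' : ∀ p, p ∉ Set.range idx → B p = Set.univ := fun p hp => by
    have h : ¬ ∃ j, idx j = p := hp
    simp only [B, h, dite_false]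
  have hpre : (fun (z : ∀ t, Fin (m t) → Z) j => z (idx j).1 (idx j).2) ⁻¹' Set.univ.pi s =
      Set.univ.pi fun t => Set.univ.pi fun i => B ⟨t, i⟩ := by
    ext z
    simp only [Set.mem_preimage, Set.mem_univ_pi]
    constructor
    · intro h t i
      by_cases hp : (⟨t, i⟩ : Σ t, Fin (m t)) ∈ Set.range idx
      · obtain ⟨j, hj⟩ := hp
        have := h j
        rw [← hB j, hj] at this
        exact this
      · rw [hB' _ hp]; trivial
    · intro h j
      rw [← hB j]
      exact h (idx j).1 (idx j).2
  rw [hpre, Measure.pi_pi]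
  simp only [Measure.pi_pi]
  rw [← Fintype.prod_sigma' fun t i => μ t (B ⟨t, i⟩)]
  have h1 : ∏ p : Σ t, Fin (m t), μ p.1 (B ⟨p.1, p.2⟩) =
      ∏ p ∈ Finset.univ.image idx, μ p.1 (B p) := by
    refine (Finset.prod_subset (Finset.subset_univ _) fun p _ hp => ?_).symm
    rw [hB' p fun ⟨j, hj⟩ => hp (Finset.mem_image.2 ⟨j, Finset.mem_univ _, hj⟩)]
    exact measure_univ
  rw [h1, Finset.prod_image hidx.injOn]
  simp only [hB]

section Aggregate

variable {X : Type*} {N n nD : ℕ}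

/-- The source of the `j`-th point of the sample that aggregates the sources in `T`. -/
noncomputable def sourceOf (T : Finset (Fin N)) (j : Fin (T.card * n)) : Fin N :=
  T.equivFin.symm (finProdFinEquiv.symm j).1

lemma sourceOf_mem (T : Finset (Fin N)) (j : Fin (T.card * n)) : sourceOf T j ∈ T :=
  (T.equivFin.symm (finProdFinEquiv.symm j).1).2

/-- The position of the `j`-th point of the aggregated sample. -/
noncomputable def positionOf (nD : ℕ) (T : Finset (Fin N)) (j : Fin (T.card * n)) :
    Σ t, Fin (sampleSizes N n nD t) :=
  ⟨(sourceOf T j).castSucc, Fin.cast (sampleSizes_castSucc N n nD _).symm (finProdFinEquiv.symm j).2⟩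

lemma positionOf_injective (T : Finset (Fin N)) :
    Function.Injective (positionOf (n := n) nD T) := by
  intro j j' h
  have h1 : sourceOf T j = sourceOf T j' := Fin.castSucc_injective _ (congrArg Sigma.fst h)
  have h2 : ((finProdFinEquiv.symm j).2 : ℕ) = (finProdFinEquiv.symm j').2 :=
    congrArg (fun p : Σ t, Fin (sampleSizes N n nD t) => (p.2 : ℕ)) h
  refine finProdFinEquiv.symm.injective (Prod.ext ?_ (Fin.ext h2))
  exact T.equivFin.symm.injective (Subtype.ext h1)

/-- The sample that aggregates the sources in `T`. -/
noncomputable def aggregate (T : Finset (Fin N)) (z : Multisample X (sampleSizes N n nD)) :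
    Fin (T.card * n) → X × Bool :=
  fun j => z (positionOf nD T j).1 (positionOf nD T j).2

lemma sampleLaw_preimage_aggregate_le [MeasurableSpace X] (T : Finset (Fin N))
    (P : Fin (N + 1) → ProbabilityMeasure (X × Bool)) (S : Set (Fin (T.card * n) → X × Bool)) :
    sampleLaw P (sampleSizes N n nD) (aggregate T ⁻¹' S) ≤
      Measure.pi (fun j => (P (sourceOf T j).castSucc : Measure (X × Bool))) S := by
  have hmeas : Measurable (aggregate (X := X) (n := n) (nD := nD) T) :=
    measurable_pi_lambda _ fun j => (measurable_pi_apply _).comp (measurable_pi_apply _)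
  refine (Measure.le_map_apply hmeas.aemeasurable S).trans (le_of_eq ?_)
  congr 1
  exact map_pi_pi_eval (fun t => (P t : Measure (X × Bool))) (positionOf nD T)
    (positionOf_injective T)

/-! ### Ranked pools, their deviation levels, and the learner. -/

/-- The sources among the first `k` tasks in the order `π`. -/
def firstSources (π : Equiv.Perm (Fin (N + 1))) (k : ℕ) : Finset (Fin N) :=
  Finset.univ.filter fun t => (π.symm t.castSucc : ℕ) < k

/-- The deviation level for the sources among the first `k` tasks. -/
noncomputable def deviationLevel (V n k L : ℕ) : ℝ :=
  Real.log (4 * (L + 1) * growthBound V (2 * L)) + 2 * Real.log (n * k)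

lemma deviationLevel_pos {V n k : ℕ} (hn : 1 ≤ n) (hk : 1 ≤ k) (L : ℕ) :
    0 < deviationLevel V n k L := by
  have h1 : (1:ℝ) ≤ growthBound V (2 * L) := by exact_mod_cast one_le_growthBound V (2 * L)
  have h2 : (1:ℝ) ≤ n * k := by exact_mod_cast Nat.one_le_iff_ne_zero.2 (by positivity)
  have h3 : (1:ℝ) < 4 * (L + 1) * growthBound V (2 * L) := by
    have : (0:ℝ) ≤ L := by positivity
    nlinarith
  have := Real.log_pos h3
  have := Real.log_nonneg h2
  unfold deviationLevel
  linarith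

/-- The term `2 * Real.log (n * k)` makes the failure probabilities summable in `k`, with tail of
order `1 / (n ^ 2 * k)`, which does not exceed the order of the rate. -/
lemma four_mul_growthBound_mul_exp {V n k : ℕ} (hn : 1 ≤ n) (hk : 1 ≤ k) (L : ℕ) :
    4 * (L + 1) * growthBound V (2 * L) * Real.exp (-deviationLevel V n k L) =
      1 / ((n:ℝ) * k) ^ 2 := by
  have h1 : (1:ℝ) ≤ growthBound V (2 * L) := by exact_mod_cast one_le_growthBound V (2 * L)
  have h2 : (0:ℝ) < n * k := by positivity
  have h3 : (0:ℝ) < 4 * (L + 1) * growthBound V (2 * L) := by positivity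
  rw [deviationLevel, Real.exp_neg, Real.exp_add, Real.exp_log h3,
    show 2 * Real.log ((n:ℝ) * k) = Real.log ((n * k) ^ 2) by rw [Real.log_pow]; norm_num,
    Real.exp_log (by positivity)]
  field_simp

/-- Take a common element of the sets from the least possible `k` on. It lies in the sets of every
shorter range, so the relevant `k` need not be known. -/
lemma exists_longest_candidate {A : Type*} {H : Set A} (hH : H.Nonempty) (C : ℕ → Set A) (K : ℕ) :
    ∃ h ∈ H, ∀ k, (∃ g ∈ H, ∀ j, k ≤ j → j ≤ K → g ∈ C j) → ∀ j, k ≤ j → j ≤ K → h ∈ C j := by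
  classical
  by_cases hex : ∃ k, ∃ g ∈ H, ∀ j, k ≤ j → j ≤ K → g ∈ C j
  · obtain ⟨g, hg, hgC⟩ := Nat.find_spec hex
    exact ⟨g, hg, fun k hk j hkj hjK => hgC j ((Nat.find_min' hex hk).trans hkj) hjK⟩
  · obtain ⟨h, hh⟩ := hH
    exact ⟨h, hh, fun k hk => absurd ⟨k, hk⟩ hex⟩

/-- A learner that is consistent with the longest possible range of aggregated samples. -/
lemma exists_learner {H : Set (X → Bool)} (hH : H.Nonempty) (V n nD N : ℕ) :
    ∃ h : Equiv.Perm (Fin (N + 1)) → Learner H (sampleSizes N n nD), ∀ π z k,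
      (∃ g ∈ H, ∀ j, k ≤ j → j ≤ N + 1 → g ∈ candidates H
        (deviationLevel V n j ((firstSources π j).card * n)) (aggregate (firstSources π j) z)) →
      ∀ j, k ≤ j → j ≤ N + 1 → (h π z : X → Bool) ∈ candidates H
        (deviationLevel V n j ((firstSources π j).card * n)) (aggregate (firstSources π j) z) := by
  have key := fun (π : Equiv.Perm (Fin (N + 1))) (z : Multisample X (sampleSizes N n nD)) =>
    exists_longest_candidate hH (fun j => candidates H
        (deviationLevel V n j ((firstSources π j).card * n)) (aggregate (firstSources π j) z)) (N + 1)
  choose f hf hf' using key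
  exact ⟨fun π z => ⟨f π z, hf π z⟩, hf'⟩

/-- The tasks with exponent at most `1`, the target included, come first in a ranking. -/
lemma firstSources_eq {ρ : Fin N → ℝ≥0∞} {π : Equiv.Perm (Fin (N + 1))} (hπ : IsRanking ρ π) :
    firstSources π (({t | ρ t ≤ 1} : Set (Fin N)).ncard + 1) =
      Finset.univ.filter fun t => ρ t ≤ 1 := by
  classical
  set A : Finset (Fin (N + 1)) := Finset.univ.filter fun j => allExponents ρ (π j) ≤ 1 with hA
  have hcard : A.card = ({t | ρ t ≤ 1} : Set (Fin N)).ncard + 1 := by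
    have h1 : A.card = (Finset.univ.filter fun t => allExponents ρ t ≤ 1).card :=
      Finset.card_equiv π fun j => by simp [hA]
    have h2 : ({t | ρ t ≤ 1} : Set (Fin N)).ncard = (Finset.univ.filter fun t => ρ t ≤ 1).card := by
      rw [← Set.ncard_coe_finset]; simp
    rw [h1, h2, Finset.card_filter, Fin.sum_univ_castSucc, Finset.card_filter]
    simp [allExponents]
  have hlow : ∀ i j, i ≤ j → j ∈ A → i ∈ A := by
    intro i j hij hj
    rw [hA, Finset.mem_filter] at hj ⊢
    exact ⟨Finset.mem_univ _, (hπ hij).trans hj.2⟩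
  -- An initial segment of `Fin (N + 1)` is determined by its size. This makes the order among tied
  -- tasks irrelevant.
  have hmem : ∀ j, j ∈ A ↔ (j : ℕ) < A.card := by
    intro j
    constructor
    · intro hj
      have : Finset.Iic j ⊆ A := fun i hi => hlow i j (Finset.mem_Iic.1 hi) hj
      have := Finset.card_le_card this
      rw [Fin.card_Iic] at this
      omega
    · intro hj
      by_contra hjA
      have : A ⊆ Finset.Iio j := fun i hi => by
        rw [Finset.mem_Iio]
        by_contra hij
        exact hjA (hlow j i (not_lt.1 hij) hi)
      have := Finset.card_le_card this
      rw [Fin.card_Iio] at this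
      omega
  ext t
  simp only [firstSources, Finset.mem_filter, Finset.mem_univ, true_and]
  rw [← hcard, ← hmem, hA, Finset.mem_filter, Equiv.apply_symm_apply]
  simp [allExponents]

end Aggregate

/-! ### Numerical bounds on the rate -/

lemma one_le_posLog (x : ℝ) : 1 ≤ posLog x := le_max_right _ _

lemma log_le_posLog (x : ℝ) : Real.log x ≤ posLog x := le_max_left _ _

/-- The function `posLog x / x` is decreasing up to constants, so the size of a pool may be replaced
by a lower bound, even one that overshoots by a factor 2. -/
lemma posLog_div_le {x y : ℝ} (hx : 0 < x) (hy : 0 < y) (hxy : x / 2 ≤ y) :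
    posLog y / y ≤ 3 * (posLog x / x) := by
  have h1 := one_le_posLog x
  have h2 : Real.log y ≤ Real.log x + (y / x - 1) := by
    have := Real.log_le_sub_one_of_pos (div_pos hy hx)
    rw [Real.log_div hy.ne' hx.ne'] at this
    linarith
  have h3 : 1 / 2 ≤ y / x := by rw [le_div_iff₀ hx]; linarith
  have h4 : posLog y ≤ 3 * (y / x) * posLog x := by
    have h5 : posLog x ≤ 2 * (y / x) * posLog x := by nlinarith
    have h6 : y / x ≤ y / x * posLog x := by nlinarith
    have h7 := log_le_posLog x
    exact max_le (by nlinarith) (by nlinarith)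
  rw [div_le_iff₀ hy]
  calc posLog y ≤ 3 * (y / x) * posLog x := h4
    _ = 3 * (posLog x / x) * y := by field_simp

lemma deviationLevel_le {V n k L : ℕ} (hV : 1 ≤ V) (hVL : V ≤ 2 * L) (hn : 1 ≤ n) (hk : 1 ≤ k)
    (hL : 1 ≤ L) (hnk : n * k ≤ 2 * L) :
    deviationLevel V n k L ≤ 7 * (V * posLog (L / V) + posLog L) := by
  have hV1 : (1:ℝ) ≤ V := by exact_mod_cast hV
  have hL1 : (1:ℝ) ≤ L := by exact_mod_cast hL
  have hG0 : (0:ℝ) < growthBound V (2 * L) := by exact_mod_cast one_le_growthBound V (2 * L)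
  have l2 := Real.log_two_lt_d9
  have e8 : Real.log 8 = 3 * Real.log 2 := by
    rw [show (8:ℝ) = 2 ^ 3 by norm_num, Real.log_pow]; norm_num
  have h1 : Real.log (4 * (L + 1)) ≤ 3 * Real.log 2 + Real.log L := by
    rw [← e8, ← Real.log_mul (by norm_num) (by positivity)]
    exact Real.log_le_log (by positivity) (by linarith)
  have h2 : Real.log (growthBound V (2 * L)) ≤ V * (1 + (Real.log 2 + Real.log (L / V))) := by
    have := Real.log_le_log hG0 (growthBound_le_pow hV hVL)
    rwa [Real.log_pow, Real.log_mul (by positivity) (by positivity), Real.log_exp,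
      show ((2 * L : ℕ) : ℝ) / V = 2 * (L / V) by push_cast; ring,
      Real.log_mul (by norm_num) (by positivity)] at this
  have h3 : Real.log (n * k) ≤ Real.log 2 + Real.log L := by
    rw [← Real.log_mul (by norm_num) (by positivity)]
    exact Real.log_le_log (by positivity) (by exact_mod_cast hnk)
  have h4 := log_le_posLog (L : ℝ)
  have h5 := log_le_posLog ((L : ℝ) / V)
  have h6 := one_le_posLog (L : ℝ)
  have h7 := one_le_posLog ((L : ℝ) / V)
  have h8 : (V:ℝ) * (1 + (Real.log 2 + Real.log (L / V))) ≤ V * (7 * posLog (L / V)) := by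
    gcongr
    linarith
  unfold deviationLevel
  rw [Real.log_mul (by positivity) hG0.ne']
  linarith

lemma deviationLevel_div_le {V n k L : ℕ} {B : ℝ} (hV : 1 ≤ V) (hVL : V ≤ 2 * L) (hn : 1 ≤ n)
    (hk : 1 ≤ k) (hL : 1 ≤ L) (hnk : n * k ≤ 2 * L) (hB : 0 < B) (hBL : B / 2 ≤ L) :
    deviationLevel V n k L / L ≤ 21 * ((V * posLog (B / V) + posLog B) / B) := by
  have hV0 : (0:ℝ) < V := by exact_mod_cast hV
  have hL0 : (0:ℝ) < L := by exact_mod_cast hL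
  have h1 := posLog_div_le hB hL0 hBL
  have h2 := posLog_div_le (div_pos hB hV0) (div_pos hL0 hV0)
    (by rw [div_right_comm]; gcongr)
  have e1 : posLog (L / V) / (L / V) = V * posLog (L / V) / L := by field_simp
  have e2 : posLog (B / V) / (B / V) = V * posLog (B / V) / B := by field_simp
  rw [e1, e2] at h2
  calc deviationLevel V n k L / L ≤ 7 * (V * posLog (L / V) + posLog L) / L := by
        gcongr
        exact deviationLevel_le hV hVL hn hk hL hnk
    _ = 7 * (V * posLog (L / V) / L + posLog L / L) := by ring
    _ ≤ 7 * (3 * (V * posLog (B / V) / B) + 3 * (posLog B / B)) := by gcongr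
    _ = _ := by ring

/-! ### The upper bound -/

/-- Neither `f` nor `S` is measurable; `b` plus the indicator of a measurable hull of `S` is an
admissible majorant. -/
lemma expectation_le_add {Ω : Type*} [MeasurableSpace Ω] (μ : Measure Ω) [IsProbabilityMeasure μ]
    {f : Ω → ℝ≥0∞} {b : ℝ≥0∞} {S : Set Ω} (h1 : ∀ ω, f ω ≤ 1) (hb : ∀ ω ∉ S, f ω ≤ b) :
    expectation μ f ≤ b + μ S := by
  have hT := measurableSet_toMeasurable μ S
  refine (iInf₂_le_of_le (fun ω => b + (toMeasurable μ S).indicator 1 ω)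
    (measurable_const.add (measurable_one.indicator hT)) (iInf_le _ fun ω => ?_)).trans (le_of_eq ?_)
  · dsimp only
    by_cases hω : ω ∈ S
    · rw [Set.indicator_of_mem (subset_toMeasurable _ _ hω)]
      exact (h1 ω).trans le_add_self
    · exact (hb ω hω).trans le_self_add
  · rw [lintegral_add_left measurable_const, lintegral_indicator_one hT, measure_toMeasurable]
    simp

lemma expectation_le_one {Ω : Type*} [MeasurableSpace Ω] (μ : Measure Ω) [IsProbabilityMeasure μ]
    {f : Ω → ℝ≥0∞} (h1 : ∀ ω, f ω ≤ 1) : expectation μ f ≤ 1 := by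
  simpa using expectation_le_add μ (S := ∅) h1 fun ω _ => h1 ω

instance {X : Type*} [MeasurableSpace X] {N : ℕ} (P : Fin (N + 1) → ProbabilityMeasure (X × Bool))
    (m : Fin (N + 1) → ℕ) : IsProbabilityMeasure (sampleLaw P m) := by
  unfold sampleLaw; infer_instance

lemma one_le_of_vcDim {X : Type*} {H : Set (X → Bool)} {V : ℕ} (hV : vcDim H = V)
    (h3 : 3 ≤ H.encard) : 1 ≤ V := by
  obtain ⟨g, x₀, x₁, a₀, hg, -, hg1⟩ := exists_agree_differ h3
  have hS : Shatters H {x₁} := fun f => ⟨g (f x₁), hg _, fun x hx => by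
    rw [Finset.mem_singleton.1 hx, hg1]⟩
  simpa using card_le_of_shatters hV hS

section Upper

variable {X : Type*} [MeasurableSpace X] {H : Set (X → Bool)}

/-- The power `1 / ρ` is at least 1 and excess risks are at most 1, so the power only decreases
them. -/
lemma HasTransferExponent.excessRisk_le {P D : Measure (X × Bool)} [IsProbabilityMeasure P]
    {ρ : ℝ≥0∞} (hP : HasTransferExponent H 3 ρ P D) (hρ0 : 0 < ρ) (hρ1 : ρ ≤ 1) {h : X → Bool}
    (hh : h ∈ H) : excessRisk H D h ≤ 3 * excessRisk H P h := by
  refine (hP h hh).trans ?_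
  have h1 : 1 ≤ (ρ⁻¹).toReal := by
    rw [← ENNReal.toReal_one]
    exact ENNReal.toReal_mono (ENNReal.inv_ne_top.2 hρ0.ne') (ENNReal.one_le_inv.2 hρ1)
  have h0 := excessRisk_nonneg (P := P) hh
  gcongr
  rcases h0.eq_or_lt with h | h
  · rw [← h, Real.zero_rpow (by linarith)]
  · simpa using Real.rpow_le_rpow_of_exponent_ge h (excessRisk_le_one hh) h1

/-- The samples on which all aggregates of at least `k` tasks are good. -/
lemma measure_bad_samples_le {N n nD V : ℕ} (hH : ∀ h ∈ H, Measurable h) (hT : TraceMeasurable H)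
    (hV : vcDim H = V) (hn : 1 ≤ n) {g : X → Bool} (hg : Measurable g)
    (P : Fin (N + 1) → ProbabilityMeasure (X × Bool)) (π : Equiv.Perm (Fin (N + 1)))
    {k : ℕ} (hk : 1 ≤ k) :
    sampleLaw P (sampleSizes N n nD) {z | ∃ j, k ≤ j ∧ j ≤ N + 1 ∧
      aggregate (firstSources π j) z ∉ goodSamples H
        (fun i => (P (sourceOf (firstSources π j) i).castSucc : Measure (X × Bool))) g
        (deviationLevel V n j ((firstSources π j).card * n))} ≤ ENNReal.ofReal (2 / (n * k)) := by
  set B : ℕ → Set (Multisample X (sampleSizes N n nD)) := fun j =>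
    aggregate (firstSources π j) ⁻¹' (goodSamples H
        (fun i => (P (sourceOf (firstSources π j) i).castSucc : Measure (X × Bool))) g
        (deviationLevel V n j ((firstSources π j).card * n)))ᶜ with hB
  have hn1 : (1:ℝ) ≤ n := by exact_mod_cast hn
  have hBm : ∀ j, 1 ≤ j → sampleLaw P (sampleSizes N n nD) (B j) ≤
      ENNReal.ofReal (1 / ((n:ℝ) * j) ^ 2) := by
    intro j hj
    refine (sampleLaw_preimage_aggregate_le _ _ _).trans ((measure_compl_goodSamples_le hH hT hV hg
      (deviationLevel_pos hn hj _)).trans (le_of_eq ?_))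
    rw [four_mul_growthBound_mul_exp hn hj]
  have hsub : {z | ∃ j, k ≤ j ∧ j ≤ N + 1 ∧
      aggregate (firstSources π j) z ∉ goodSamples H
        (fun i => (P (sourceOf (firstSources π j) i).castSucc : Measure (X × Bool))) g
        (deviationLevel V n j ((firstSources π j).card * n))} ⊆
      ⋃ j ∈ Finset.Ioo (k - 1) (N + 2), B j := by
    rintro z ⟨j, hkj, hjN, hz⟩
    simp only [Set.mem_iUnion]
    exact ⟨j, Finset.mem_Ioo.2 ⟨by omega, by omega⟩, hz⟩
  refine (measure_mono hsub).trans ((measure_biUnion_finset_le _ _).trans ?_)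
  calc ∑ j ∈ Finset.Ioo (k - 1) (N + 2), sampleLaw P (sampleSizes N n nD) (B j)
      ≤ ∑ j ∈ Finset.Ioo (k - 1) (N + 2), ENNReal.ofReal (1 / ((n:ℝ) * j) ^ 2) :=
        Finset.sum_le_sum fun j hj => hBm j (by have := (Finset.mem_Ioo.1 hj).1; omega)
    _ = ENNReal.ofReal (∑ j ∈ Finset.Ioo (k - 1) (N + 2), 1 / ((n:ℝ) * j) ^ 2) :=
        (ENNReal.ofReal_sum_of_nonneg fun j _ => by positivity).symm
    _ ≤ ENNReal.ofReal (2 / (n * k)) := by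
        refine ENNReal.ofReal_le_ofReal ?_
        -- The open interval from `k - 1` to `N + 2` is the range `k ≤ j ≤ N + 1`, and its lower end
        -- gives the bound `2 / k`.
        have hs := sum_Ioo_inv_sq_le (α := ℝ) (k - 1) (N + 2)
        have hk' : ((k - 1 : ℕ) : ℝ) + 1 = k := by
          rw [Nat.cast_sub hk]; push_cast; ring
        rw [hk'] at hs
        have hk0 : (0:ℝ) < k := by exact_mod_cast hk
        calc ∑ j ∈ Finset.Ioo (k - 1) (N + 2), 1 / ((n:ℝ) * j) ^ 2
            = 1 / (n:ℝ) ^ 2 * ∑ j ∈ Finset.Ioo (k - 1) (N + 2), ((j:ℝ) ^ 2)⁻¹ := by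
              rw [Finset.mul_sum]
              exact Finset.sum_congr rfl fun j _ => by rw [mul_pow, one_div, mul_inv, one_div]
          _ ≤ 1 / (n:ℝ) ^ 2 * (2 / k) := by gcongr
          _ ≤ 1 / n * (2 / k) := by
              gcongr
              nlinarith
          _ = 2 / (n * k) := by field_simp

/-- The guarantee of the learner, for the number of sources with exponent at most `1`. -/
lemma expectation_excessRisk_le {N n nD V : ℕ} (hH : ∀ h ∈ H, Measurable h)
    (hT : TraceMeasurable H) (hV : vcDim H = V) (hV1 : 1 ≤ V) (hn : 1 ≤ n) {NQ : ℕ}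
    (hNQ : 1 ≤ NQ) {β Cβ : ℝ} (hβ : 0 ≤ β) (hβ1 : β < 1) (hC : 1 ≤ Cβ)
    {ρ : Fin N → ℝ≥0∞} (hρ : ρ ∈ exponentFamily N NQ) {π : Equiv.Perm (Fin (N + 1))}
    (hπ : IsRanking ρ π) {P : Fin (N + 1) → ProbabilityMeasure (X × Bool)}
    (hP : P ∈ multisourceClass H 3 ρ Cβ β) (h : Learner H (sampleSizes N n nD))
    (hh : ∀ z k, (∃ g ∈ H, ∀ j, k ≤ j → j ≤ N + 1 → g ∈ candidates H
        (deviationLevel V n j ((firstSources π j).card * n)) (aggregate (firstSources π j) z)) →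
      ∀ j, k ≤ j → j ≤ N + 1 → (h z : X → Bool) ∈ candidates H
        (deviationLevel V n j ((firstSources π j).card * n)) (aggregate (firstSources π j) z)) :
    expectation (sampleLaw P (sampleSizes N n nD))
        (fun z => ENNReal.ofReal (excessRisk H (P (Fin.last N)) (h z))) ≤
      ENNReal.ofReal (30000 *
        (Cβ * ((V : ℝ) * posLog ((n : ℝ) * NQ / V) + posLog ((n : ℝ) * NQ)) /
          ((n : ℝ) * NQ)) ^ (1 / (2 - β))) := by
  have h2 : 0 < 2 - β := by linarith
  have hr0 : 0 < 1 / (2 - β) := by positivity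
  have hr1 : 1 / (2 - β) ≤ 1 := by rw [div_le_one h2]; linarith
  have hone : ∀ z, ENNReal.ofReal (excessRisk H (P (Fin.last N)) (h z)) ≤ 1 := fun z => by
    rw [← ENNReal.ofReal_one]
    exact ENNReal.ofReal_le_ofReal (excessRisk_le_one (h z).2)
  have hn1 : (1:ℝ) ≤ n := by exact_mod_cast hn
  have hNQ1 : (1:ℝ) ≤ NQ := by exact_mod_cast hNQ
  have hVr : (1:ℝ) ≤ V := by exact_mod_cast hV1
  obtain ⟨B, hBdef⟩ : ∃ B : ℝ, B = n * NQ := ⟨_, rfl⟩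
  rw [← hBdef]
  have hB : 0 < B := by rw [hBdef]; positivity
  obtain ⟨ψ, hψdef⟩ : ∃ ψ, ψ = ((V : ℝ) * posLog (B / V) + posLog B) / B := ⟨_, rfl⟩
  rw [mul_div_assoc, ← hψdef]
  have p1 := one_le_posLog B
  have p2 := one_le_posLog (B / V)
  have hψV : V / B ≤ ψ := by
    rw [hψdef]; gcongr; nlinarith
  have hψ1 : 1 / B ≤ ψ := by
    rw [hψdef]; gcongr; nlinarith
  have hψ0 : 0 < ψ := lt_of_lt_of_le (by positivity) hψ1
  have hψC : ψ ≤ Cβ * ψ := by nlinarith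
  -- If the claimed rate exceeds 1, the trivial bound on the excess risk suffices. Otherwise `V ≤ B
  -- ≤ 2 * L`, as the power form of the growth bound requires.
  rcases le_total 1 (Cβ * ψ) with hbig | hsmall
  · refine (expectation_le_one _ hone).trans ?_
    rw [← ENNReal.ofReal_one]
    refine ENNReal.ofReal_le_ofReal ?_
    have := Real.one_le_rpow hbig hr0.le
    linarith
  -- the sources with exponent at most one
  obtain ⟨⟨g, hg⟩, htransfer, hbern⟩ := hP
  have hgH : g ∈ H := (hg 0).1
  obtain ⟨hρ0, hρcard⟩ := hρ
  -- The extra 1 is the target, whose exponent is 1; it counts in the ranking but contributes no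
  -- points to the pool.
  obtain ⟨k, hk⟩ : ∃ k, k = ({t | ρ t ≤ 1} : Set (Fin N)).ncard + 1 := ⟨_, rfl⟩
  have hT0 : firstSources π k = Finset.univ.filter fun t => ρ t ≤ 1 := by
    rw [hk]; exact firstSources_eq hπ
  have hcard : (firstSources π k).card + 1 = k := by
    rw [hT0, hk, ← Set.ncard_coe_finset]; simp
  have hcard1 : (NQ:ℝ) / 2 ≤ (firstSources π k).card := by
    refine hρcard.trans (le_of_eq ?_)
    have : ({t | ρ t ≤ 1} : Set (Fin N)).ncard = (firstSources π k).card := by omega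
    rw [this]
  have hkN : k ≤ N + 1 := by
    have := Finset.card_le_univ (firstSources π k)
    rw [Fintype.card_fin] at this
    omega
  have hc1 : 1 ≤ (firstSources π k).card := by
    have : (0:ℝ) < (firstSources π k).card := by linarith
    exact_mod_cast this
  obtain ⟨L, hLdef⟩ : ∃ L, L = (firstSources π k).card * n := ⟨_, rfl⟩
  have hL1 : 1 ≤ L := by rw [hLdef]; exact Nat.mul_pos hc1 hn
  have hnk : n * k ≤ 2 * L := by
    calc n * k ≤ n * (2 * (firstSources π k).card) := Nat.mul_le_mul_left n (by omega)
      _ = 2 * L := by rw [hLdef]; ring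
  have hBL : B / 2 ≤ L := by
    rw [hBdef, hLdef]; push_cast; nlinarith
  have hVL : V ≤ 2 * L := by
    have : (V:ℝ) / B ≤ 1 := hψV.trans (hψC.trans hsmall)
    rw [div_le_one hB] at this
    have : (V:ℝ) ≤ 2 * L := by linarith
    exact_mod_cast this
  have hk1 : 1 ≤ k := by omega
  have hu := deviationLevel_pos (V := V) hn hk1 ((firstSources π k).card * n)
  have hdev : deviationLevel V n k L / L ≤ 21 * ψ := by
    rw [hψdef]
    exact deviationLevel_div_le hV1 hVL hn hk1 hL1 hnk hB hBL
  -- the bad event and the bound off it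
  refine (expectation_le_add _ (b := ENNReal.ofReal (29000 * (Cβ * ψ) ^ (1 / (2 - β)))) hone ?_).trans
    ((add_le_add_right (measure_bad_samples_le hH hT hV hn (hH g hgH) P π hk1) _).trans ?_)
  · intro z hz
    refine ENNReal.ofReal_le_ofReal ?_
    simp only [Set.mem_ofPred_eq, not_exists, not_and, not_not] at hz
    -- The common best classifier witnesses the range from `k` on, also for pools that contain
    -- sources of large exponent, because it is best for every task.
    have hcand := hh z k ⟨g, hgH, fun j hkj hjN => mem_candidates_of_goodSamples hH
      (fun i => hg _) hgH (deviationLevel_pos hn (hk1.trans hkj) _) (hz j hkj hjN)⟩ k le_rfl hkN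
    have havg : (∑ i, excessRisk H (P (sourceOf (n := n) (firstSources π k) i).castSucc) (h z)) / L ≤
        432 * (Cβ * (deviationLevel V n k L / L)) ^ (1 / (2 - β)) := by
      rw [hLdef]
      exact average_excessRisk_le_of_goodSamples hH (fun i => hg _) hgH hu (hLdef ▸ hL1)
        hβ hβ1 hC (fun i => hbern _) (hz k le_rfl hkN) hcand
    have hL0 : (0:ℝ) < L := by exact_mod_cast hL1
    have hE : excessRisk H (P (Fin.last N)) (h z) ≤ 3 * ((∑ i,
        excessRisk H (P (sourceOf (n := n) (firstSources π k) i).castSucc) (h z)) / L) := by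
      rw [← mul_div_assoc, le_div_iff₀ hL0, Finset.mul_sum]
      calc excessRisk H (P (Fin.last N)) (h z) * L
          = ∑ _i : Fin ((firstSources π k).card * n), excessRisk H (P (Fin.last N)) (h z) := by
            rw [hLdef]; simp; ring
        _ ≤ _ := by
            refine Finset.sum_le_sum fun i _ => ?_
            have hmem := Finset.ext_iff.1 hT0 (sourceOf (firstSources π k) i)
            exact (htransfer _).excessRisk_le (hρ0 _)
              (Finset.mem_filter.1 (hmem.1 (sourceOf_mem _ i))).2 (h z).2
    have hrate : (Cβ * (deviationLevel V n k L / L)) ^ (1 / (2 - β)) ≤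
        21 * (Cβ * ψ) ^ (1 / (2 - β)) := by
      have hdev0 : 0 ≤ deviationLevel V n k L / L := by
        have := deviationLevel_pos (V := V) hn hk1 L
        positivity
      calc (Cβ * (deviationLevel V n k L / L)) ^ (1 / (2 - β))
          ≤ (21 * (Cβ * ψ)) ^ (1 / (2 - β)) := by
            refine Real.rpow_le_rpow (by positivity) ?_ hr0.le
            calc Cβ * (deviationLevel V n k L / L) ≤ Cβ * (21 * ψ) := by gcongr
              _ = 21 * (Cβ * ψ) := by ring
        _ = 21 ^ (1 / (2 - β)) * (Cβ * ψ) ^ (1 / (2 - β)) :=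
            Real.mul_rpow (by norm_num) (by positivity)
        _ ≤ 21 * (Cβ * ψ) ^ (1 / (2 - β)) := by
            gcongr
            simpa using Real.rpow_le_rpow_of_exponent_le (by norm_num : (1:ℝ) ≤ 21) hr1
    -- The constant is the product of 3 (transfer), 432 (Bernstein rate) and 21 (deviation level),
    -- below 29000; the bad event adds at most 4 more.
    have hpos : 0 ≤ (Cβ * ψ) ^ (1 / (2 - β)) := by positivity
    linarith
  · rw [← ENNReal.ofReal_add (by positivity) (by positivity)]
    refine ENNReal.ofReal_le_ofReal ?_
    have h3 : Cβ * ψ ≤ (Cβ * ψ) ^ (1 / (2 - β)) := by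
      simpa using Real.rpow_le_rpow_of_exponent_ge (by positivity) hsmall hr1
    have h4 : 2 / ((n:ℝ) * k) ≤ 4 * (1 / B) := by
      have hkr : (NQ:ℝ) / 2 ≤ k := by
        refine hcard1.trans ?_
        exact_mod_cast (by omega : (firstSources π k).card ≤ k)
      rw [hBdef, mul_one_div, div_le_div_iff₀ (by positivity) (by positivity)]
      nlinarith
    linarith

end Upper

end Multisource

open Multisource
theorem mainTheorem2 :
    ∃ C₀ C₁ c C : ℝ, 0 < C₀ ∧ 0 < C₁ ∧ 0 < c ∧ 0 < C ∧
      ∀ (X : Type*) [MeasurableSpace X] (H : Set (X → Bool)) (V : ℕ),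
        (∀ h ∈ H, Measurable h) → Multisource.vcDim H = (V : ℕ∞) → 3 ≤ H.encard →
        -- no learner without knowledge of the class beats the target-only rate
        (∀ (β Cβ : ℝ) (n nD NP NQ : ℕ), Regime C₀ C₁ β Cβ n NP NQ →
          ENNReal.ofReal c ≤
            ⨅ h : Learner H (sampleSizes (NP + NQ) n nD),
              ⨆ ρ ∈ exponentFamily (NP + NQ) NQ,
                ⨆ P ∈ multisourceClass H 3 ρ Cβ β,
                  sampleLaw P (sampleSizes (NP + NQ) n nD)
                    {z | 1 / 4 * targetRate β nD ≤
                      excessRisk H (P (Fin.last (NP + NQ))) (h z)}) ∧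
        -- a learner that is given, besides the data, only a ranking of the tasks
        (TraceMeasurable H → ∀ n nD N : ℕ,
          ∃ h : Equiv.Perm (Fin (N + 1)) → Learner H (sampleSizes N n nD),
            ∀ (β Cβ : ℝ) (NP NQ : ℕ), Regime C₀ C₁ β Cβ n NP NQ → N = NP + NQ →
              ∀ ρ ∈ exponentFamily N NQ, ∀ π : Equiv.Perm (Fin (N + 1)), IsRanking ρ π →
                ∀ P ∈ multisourceClass H 3 ρ Cβ β,
                  expectation (sampleLaw P (sampleSizes N n nD))
                      (fun z => ENNReal.ofReal (excessRisk H (P (Fin.last N)) (h π z))) ≤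
                    ENNReal.ofReal (C *
                      (Cβ * ((V : ℝ) * posLog ((n : ℝ) * NQ / V) + posLog ((n : ℝ) * NQ)) /
                        ((n : ℝ) * NQ)) ^ (1 / (2 - β)))) := by
  refine ⟨1000, 1000, 1 / 50, 30000, by norm_num, by norm_num, by norm_num, by norm_num, ?_⟩
  intro X _ H V hH hV h3
  refine ⟨fun β Cβ n nD NP NQ hR => le_iInf fun h => ?_, fun hT n nD N => ?_⟩
  · obtain ⟨ρ, hρ, P, hP, hle⟩ := exists_hard_member hH h3 hR rfl rfl h
    exact hle.trans (le_iSup₂_of_le ρ hρ (le_iSup₂_of_le P hP le_rfl))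
  · have hne : H.Nonempty := by
      rw [Set.nonempty_iff_ne_empty]
      rintro rfl
      simp at h3
    obtain ⟨h, hh⟩ := exists_learner hne V n nD N
    refine ⟨h, fun β Cβ NP NQ hR _ ρ hρ π hπ P hP => ?_⟩
    have hNQ : 1 ≤ NQ := by
      have : (1:ℝ) ≤ NQ := by linarith [hR.le_NQ]
      exact_mod_cast this
    exact expectation_excessRisk_le hH hT hV (one_le_of_vcDim hV h3) hR.one_le_n hNQ
      hR.beta_nonneg hR.beta_lt_one (by linarith [hR.two_le_Cbeta]) hρ hπ hP (h π) (hh π)
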